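/- **ELSC/ELSS guarantee for the sigmoid activation.** Let $\sigma(v)=1/(1+e^{-v})$ and, for $\tau>0$, let $\sigma_\tau(v)=\sigma(\tau v)$. Given covariates $x_1,\dots,x_n\in\mathbb R^d$ and a gold model $w_*\in\mathbb R^d$, let $y_i=\sigma(\langle x_i,w_*\rangle)$ be the noiseless labels, $y_i^\tau=\sigma_\tau(\sigma^{-1}(y_i))$ the graduated labels, and $$\mathcal L_\tau(w)=\frac1n\sum_{i=1}^n\bigl(y_i^\tau-\sigma_\tau(\langle x_i,w\rangle)\bigr)^2$$ the $\tau$-graduated objective. On the closed ball $\mathcal B(w_*,r)$ we say that $\mathcal L_\tau$ is $\lambda$-strongly convex (resp. $\Lambda$-strongly smooth) if for all $u,v\in\mathcal B(w_*,r)$ $$\mathcal L_\tau(v)\ge \mathcal L_\tau(u)+\langle\nabla\mathcal L_\tau(u),v-u\rangle+\tfrac{\lambda}{2}\|u-v\|_2^2\qquad\Bigl(\text{resp. } \mathcal L_\tau(v)\le \mathcal L_\tau(u)+\langle\nabla\mathcal L_\tau(u),v-u\rangle+\tfrac{\Lambda}{2}\|u-v\|_2^2\Bigr).$$ There is a universal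 constant $c_0>0$ such that for every $R$ there are constants $C,c>0$, depending only on $R$, with the following property. Let $w_*\in\mathbb R^d$ with $\|w_*\|_2\le R$, let $n\ge C\,d\log(d+1)$, and let $x_1,\dots,x_n$ be i.i.d. $\mathcal N(0,I_d)$. Then, with probability at least $1-e^{-cn}$, simultaneously for every radius $r\in[0,2R]$ and every temperature $0<\tau\le\min\{e^{-R}/(3r),1\}$ (read as $0<\tau\le1$ if $r=0$), there are $\lambda_r,\Lambda_r>0$ such that $\mathcal L_\tau$ is $\lambda_r$-strongly convex and $\Lambda_r$-strongly smooth on $\mathcal B(w_*,r)$, and $$\lambda_r\ \ge\ c_0\,\frac{\tau^2e^{-\tau R}}{2}\ \ge\ c_0\,\frac{\tau^2e^{-R}}{2},\qquad \Lambda_r\ \le\ \tau^2e^{-\tau R}+\tau^3R\ \le\ \tau^2(1+R).$$ -/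

import Mathlib

open MeasureTheory ProbabilityTheory

namespace Agglio

noncomputable section

/-- The `τ`-graduated sigmoid `v ↦ 1 / (1 + exp (-τ v))`; since the sigmoid has a bounded range,
there is no normalization by `1 / τ`. -/
def gradSigmoid (τ : ℝ) (v : ℝ) : ℝ := Real.sigmoid (τ * v)

/-- The graduated label `σ_τ (σ⁻¹ y)` of a label `y`. The sigmoid is injective, so on its range
(where all noiseless labels lie) `Function.invFun Real.sigmoid` is its inverse. -/
def gradLabel (τ : ℝ) (y : ℝ) : ℝ := gradSigmoid τ (Function.invFun Real.sigmoid y)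

/-- The noiseless labels `y i = σ (⟨x i, w*⟩)` generated by the gold model `w*`. -/
def noiselessLabel {d n : ℕ} (x : Fin n → EuclideanSpace ℝ (Fin d))
    (wstar : EuclideanSpace ℝ (Fin d)) (i : Fin n) : ℝ :=
  Real.sigmoid (inner ℝ (x i) wstar)

/-- The `τ`-graduated least-squares objective
`w ↦ (1/n) ∑ i, (σ_τ (σ⁻¹ (y i)) - σ_τ (⟨x i, w⟩))²` of the data `(x i, y i)`. -/
def gradObjective {d n : ℕ} (x : Fin n → EuclideanSpace ℝ (Fin d)) (y : Fin n → ℝ)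
    (τ : ℝ) (w : EuclideanSpace ℝ (Fin d)) : ℝ :=
  (1 / (n : ℝ)) * ∑ i, (gradLabel τ (y i) - gradSigmoid τ (inner ℝ (x i) w)) ^ 2

/-- First-order `lam`-strong convexity of `f` within the set `s`. -/
def StronglyConvexWithin {d : ℕ} (f : EuclideanSpace ℝ (Fin d) → ℝ)
    (s : Set (EuclideanSpace ℝ (Fin d))) (lam : ℝ) : Prop :=
  ∀ u ∈ s, ∀ v ∈ s,
    f u + inner ℝ (gradient f u) (v - u) + lam / 2 * ‖u - v‖ ^ 2 ≤ f v

/-- First-order `Lam`-strong smoothness of `f` within the set `s`. -/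
def StronglySmoothWithin {d : ℕ} (f : EuclideanSpace ℝ (Fin d) → ℝ)
    (s : Set (EuclideanSpace ℝ (Fin d))) (Lam : ℝ) : Prop :=
  ∀ u ∈ s, ∀ v ∈ s,
    f v ≤ f u + inner ℝ (gradient f u) (v - u) + Lam / 2 * ‖u - v‖ ^ 2

end

end Agglio

/-! The Hessian form of the objective at w in direction z is 2τ² times the empirical mean of
`curvature` ⟨x,p⟩ ⟨x,p-u⟩ · ⟨x,z⟩², where p = τw and u = τ(w - w*). Apart from the factor τ²,
temperature and radius enter only through p and u, and the bound on τ says that ‖u‖ ≤ e^{-R}/3 on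
the ball. One event that controls this mean for all such p, u and all unit z therefore serves every
r and τ at once.

In expectation: `curvature` a b is at least σ'(a)² - |a-b|/40, and σ'(a)² ≥ e^{-a²/2}/16
(`curvature_ge`). Integrated against ⟨x,z⟩², the main term is a Gaussian integral of size at least
(1+‖p‖²)^{-3/2} ≥ e^{-‖p‖}/2, while the error costs at most a multiple of ‖u‖. Since ‖p‖ ≤ τR + 1/3,
the main term wins and leaves e^{-τR}/200 (`integral_curvature_ge`).

Concentration: each summand is dominated by the square of a standard Gaussian, so Chernoff's method
applies (`measureReal_sum_le_le_exp`). A union bound over triples (p,u,z) from a grid of mesh η/n²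
costs an exponent of order d log n, absorbed by n ≥ C d log(d+1) (`exists_sample_size_bound`). The
entries of the sample are at most n, so rounding to the grid moves each inner product by at most η;
`curvature` is Lipschitz, and the bounds pass to all vectors (`GoodSample.sum_curvature_mul_ge`).

Upper bound: |`curvature`| ≤ 13/80 and ∑⟨x,z⟩² ≤ 3n make the Hessian form at most τ²‖z‖², and τ² ≤
τ²e^{-τR} + τ³R because e^{-t} ≥ 1 - t. Taylor's formula on segments turns the Hessian bounds into
convexity and smoothness. -/

namespace Agglio

noncomputable section

/-! ### Curvature of the scalar squared loss -/

/-- The polynomial in `s = σ a`, `t = σ b` equal to half the second derivative of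
`v ↦ (σ b - σ v)²` at `a`. -/
def curvature (a b : ℝ) : ℝ :=
  (Real.sigmoid a * (1 - Real.sigmoid a)) ^ 2 +
    Real.sigmoid a * (1 - Real.sigmoid a) * (1 - 2 * Real.sigmoid a) *
      (Real.sigmoid a - Real.sigmoid b)

lemma continuous_curvature : Continuous fun p : ℝ × ℝ => curvature p.1 p.2 := by
  unfold curvature
  have := continuous_sigmoid
  fun_prop

lemma abs_sigmoid_sub_le (a b : ℝ) : |Real.sigmoid a - Real.sigmoid b| ≤ |a - b| / 4 := by
  have h := Convex.norm_image_sub_le_of_norm_hasDerivWithin_le (s := Set.univ)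
    (f := Real.sigmoid) (C := 1 / 4) (x := b) (y := a)
    (fun x _ => (Real.hasDerivAt_sigmoid x).hasDerivWithinAt) ?_ convex_univ trivial trivial
  · simp only [Real.norm_eq_abs] at h
    linarith
  · intro x _
    have h0 := Real.sigmoid_pos x
    have h1 := Real.sigmoid_lt_one x
    rw [Real.norm_eq_abs, abs_le]
    constructor <;> nlinarith [sq_nonneg (Real.sigmoid x - 1 / 2)]

lemma abs_mul_one_sub_le {s : ℝ} (h0 : 0 ≤ s) (h1 : s ≤ 1) : |s * (1 - s)| ≤ 1 / 4 := by
  rw [abs_le]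
  constructor <;> nlinarith [sq_nonneg (s - 1 / 2)]

lemma abs_cubic_le {s : ℝ} (h0 : 0 ≤ s) (h1 : s ≤ 1) :
    |s * (1 - s) * (1 - 2 * s)| ≤ 1 / 10 := by
  -- With q = s(1-s) one has (1-2s)² = 1-4q, and q²(1-4q) has maximum 1/108, at q = 1/6.
  have key : (s * (1 - s) * (1 - 2 * s)) ^ 2 ≤ (1 / 10) ^ 2 := by
    set q := s * (1 - s) with hq
    have hq0 : 0 ≤ q := mul_nonneg h0 (by linarith)
    have e : (q * (1 - 2 * s)) ^ 2 = q ^ 2 * (1 - 4 * q) := by rw [hq]; ring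
    rw [e]
    nlinarith [mul_nonneg hq0 (sq_nonneg (q - 1 / 6)), sq_nonneg (q - 1 / 6)]
  exact abs_le_of_sq_le_sq key (by norm_num)

lemma abs_cubic_mul_le (a b : ℝ) :
    |Real.sigmoid a * (1 - Real.sigmoid a) * (1 - 2 * Real.sigmoid a) *
      (Real.sigmoid a - Real.sigmoid b)| ≤
      1 / 10 * |Real.sigmoid a - Real.sigmoid b| := by
  rw [abs_mul]
  gcongr
  exact abs_cubic_le (Real.sigmoid_nonneg a) (Real.sigmoid_le_one a)

lemma abs_sigmoid_sub_le_one (a b : ℝ) : |Real.sigmoid a - Real.sigmoid b| ≤ 1 := by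
  have := Real.sigmoid_nonneg a
  have := Real.sigmoid_nonneg b
  have := Real.sigmoid_le_one a
  have := Real.sigmoid_le_one b
  rw [abs_le]
  constructor <;> linarith

/-- The bound is 1/16 + 1/10. It must be small enough that 2 · 13/80 · 3 < 1, which yields
smoothness constant τ². -/
lemma abs_curvature_le (a b : ℝ) : |curvature a b| ≤ 13 / 80 := by
  have h1 := abs_cubic_mul_le a b
  have h2 := abs_sigmoid_sub_le_one a b
  have h3 := abs_mul_one_sub_le (Real.sigmoid_nonneg a) (Real.sigmoid_le_one a)
  have h4 : |(Real.sigmoid a * (1 - Real.sigmoid a)) ^ 2| ≤ 1 / 16 := by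
    rw [abs_pow]
    calc _ ≤ (1 / 4 : ℝ) ^ 2 := by gcongr
      _ = 1 / 16 := by norm_num
  unfold curvature
  refine (abs_add_le _ _).trans ?_
  linarith

/-- σ'(a) = 1/(4 cosh²(a/2)) and cosh t ≤ e^{t²/2}. A Gaussian minorant makes the later expectations
explicit. -/
lemma sigmoid_mul_one_sub_ge (a : ℝ) :
    1 / 4 * Real.exp (-(a ^ 2 / 4)) ≤ Real.sigmoid a * (1 - Real.sigmoid a) := by
  have h := Real.cosh_le_exp_half_sq (a / 2)
  have hc := Real.cosh_pos (a / 2)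
  have e : Real.sigmoid a * (1 - Real.sigmoid a) = 1 / (4 * Real.cosh (a / 2) ^ 2) := by
    rw [← Real.sigmoid_neg, Real.sigmoid_def, Real.sigmoid_def, Real.cosh_eq, neg_neg]
    have e1 : Real.exp a = Real.exp (a / 2) ^ 2 := by
      rw [← Real.exp_nat_mul]; congr 1; push_cast; ring
    have e2 : Real.exp (-a) = (Real.exp (a / 2) ^ 2)⁻¹ := by rw [Real.exp_neg, e1]
    have hp := Real.exp_pos (a / 2)
    rw [e2, e1, Real.exp_neg]
    field_simp
    ring
  rw [e]
  have h2 : Real.cosh (a / 2) ^ 2 ≤ Real.exp (a ^ 2 / 4) := by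
    calc _ ≤ (Real.exp ((a / 2) ^ 2 / 2)) ^ 2 := by gcongr
      _ = _ := by rw [← Real.exp_nat_mul]; congr 1; push_cast; ring
  rw [Real.exp_neg, ← one_div, one_div_mul_one_div]
  exact one_div_le_one_div_of_le (by positivity) (by linarith)

lemma curvature_ge (a b : ℝ) :
    1 / 16 * Real.exp (-(a ^ 2 / 2)) - |a - b| / 40 ≤ curvature a b := by
  have h1 := (abs_le.1 (abs_cubic_mul_le a b)).1
  have h2 := abs_sigmoid_sub_le a b
  have h3 : 1 / 16 * Real.exp (-(a ^ 2 / 2)) ≤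
      (Real.sigmoid a * (1 - Real.sigmoid a)) ^ 2 := by
    calc 1 / 16 * Real.exp (-(a ^ 2 / 2)) = (1 / 4 * Real.exp (-(a ^ 2 / 4))) ^ 2 := by
          rw [mul_pow, ← Real.exp_nat_mul]
          norm_num
          ring
      _ ≤ _ := by
          exact pow_le_pow_left₀ (by positivity) (sigmoid_mul_one_sub_ge a) 2
  unfold curvature
  linarith

lemma abs_mul_sub_mul_le {x x' y y' : ℝ} (hx' : |x'| ≤ 1) (hy : |y| ≤ 1) :
    |x * y - x' * y'| ≤ |x - x'| + |y - y'| := by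
  have e : x * y - x' * y' = (x - x') * y + x' * (y - y') := by ring
  rw [e]
  refine (abs_add_le _ _).trans ?_
  rw [abs_mul, abs_mul]
  nlinarith [abs_nonneg (x - x'), abs_nonneg (y - y')]

/-- As a polynomial in (s,t) the curvature changes by at most 6|s-s'| + |t-t'|, and the sigmoid is
1/4-Lipschitz. -/
lemma abs_curvature_sub_le (a b a' b' : ℝ) :
    |curvature a b - curvature a' b'| ≤ 2 * (|a - a'| + |b - b'|) := by
  have ha := abs_sigmoid_sub_le a a'
  have hb := abs_sigmoid_sub_le b b'
  have hd := abs_sigmoid_sub_le_one a b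
  have hd' := abs_sigmoid_sub_le_one a' b'
  have s0 := Real.sigmoid_nonneg a
  have s1 := Real.sigmoid_le_one a
  have s0' := Real.sigmoid_nonneg a'
  have s1' := Real.sigmoid_le_one a'
  unfold curvature
  generalize Real.sigmoid a = s at *
  generalize Real.sigmoid b = t at *
  generalize Real.sigmoid a' = s' at *
  generalize Real.sigmoid b' = t' at *
  have hA := abs_mul_one_sub_le s0 s1
  have hA' := abs_mul_one_sub_le s0' s1'
  have hB : |1 - 2 * s| ≤ 1 := by rw [abs_le]; constructor <;> linarith
  have hAB' : |s' * (1 - s') * (1 - 2 * s')| ≤ 1 :=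
    (abs_cubic_le s0' s1').trans (by norm_num)
  have dA : |s * (1 - s) - s' * (1 - s')| ≤ |s - s'| := by
    have e : s * (1 - s) - s' * (1 - s') = (s - s') * (1 - s - s') := by ring
    rw [e, abs_mul]
    have : |1 - s - s'| ≤ 1 := by rw [abs_le]; constructor <;> linarith
    nlinarith [abs_nonneg (s - s')]
  have dB : |(1 - 2 * s) - (1 - 2 * s')| = 2 * |s - s'| := by
    rw [show (1 - 2 * s) - (1 - 2 * s') = 2 * (s' - s) by ring, abs_mul, abs_sub_comm s' s]
    norm_num
  have dC : |(s - t) - (s' - t')| ≤ |s - s'| + |t - t'| := by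
    rw [show (s - t) - (s' - t') = (s - s') - (t - t') by ring]
    exact abs_sub _ _
  have d1 := abs_mul_sub_mul_le (x := s * (1 - s)) (y := 1 - 2 * s) (y' := 1 - 2 * s')
    (hA'.trans (by norm_num)) hB
  have d2 := abs_mul_sub_mul_le (x := s * (1 - s) * (1 - 2 * s)) (y' := s' - t') hAB' hd
  have d3 := abs_mul_sub_mul_le (x := s * (1 - s)) (y' := s' * (1 - s'))
    (hA'.trans (by norm_num)) (hA.trans (by norm_num))
  rw [← sq, ← sq] at d3
  rw [add_sub_add_comm]
  refine (abs_add_le _ _).trans ?_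
  linarith [abs_nonneg (a - a'), abs_nonneg (b - b')]

/-! ### Second-order Taylor bounds and the Hessian form on segments -/

lemma taylor_lower {h h' h'' : ℝ → ℝ} (hd : ∀ t, HasDerivAt h (h' t) t)
    (hd' : ∀ t, HasDerivAt h' (h'' t) t) {m : ℝ} (hm : ∀ t ∈ Set.Icc (0 : ℝ) 1, m ≤ h'' t) :
    h 0 + h' 0 + m / 2 ≤ h 1 := by
  have g'd : ∀ t, HasDerivAt (fun t => h' t - h' 0 - m * t) (h'' t - m) t := fun t => by
    simpa using ((hd' t).sub_const (h' 0)).fun_sub ((hasDerivAt_id t).const_mul m)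
  have gd : ∀ t, HasDerivAt (fun t => h t - h' 0 * t - m / 2 * t ^ 2)
      (h' t - h' 0 - m * t) t := fun t => by
    have h1 := ((hd t).fun_sub ((hasDerivAt_id t).const_mul (h' 0))).fun_sub
      ((hasDerivAt_pow 2 t).const_mul (m / 2))
    refine h1.congr_deriv ?_
    push_cast
    ring
  have mono' : MonotoneOn (fun t => h' t - h' 0 - m * t) (Set.Icc 0 1) :=
    monotoneOn_of_deriv_nonneg (convex_Icc 0 1)
      (fun t _ => (g'd t).continuousAt.continuousWithinAt)
      (fun t _ => (g'd t).differentiableAt.differentiableWithinAt)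
      (fun t ht => by
        rw [(g'd t).deriv, sub_nonneg]
        exact hm t (interior_subset ht))
  have mono : MonotoneOn (fun t => h t - h' 0 * t - m / 2 * t ^ 2) (Set.Icc 0 1) :=
    monotoneOn_of_deriv_nonneg (convex_Icc 0 1)
      (fun t _ => (gd t).continuousAt.continuousWithinAt)
      (fun t _ => (gd t).differentiableAt.differentiableWithinAt)
      (fun t ht => by
        have ht' := interior_subset ht
        rw [(gd t).deriv]
        simpa using mono' (Set.left_mem_Icc.2 zero_le_one) ht' ht'.1)
  have := mono (Set.left_mem_Icc.2 zero_le_one) (Set.right_mem_Icc.2 zero_le_one) zero_le_one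
  simp only [mul_zero, sub_zero] at this
  norm_num at this
  linarith

lemma taylor_upper {h h' h'' : ℝ → ℝ} (hd : ∀ t, HasDerivAt h (h' t) t)
    (hd' : ∀ t, HasDerivAt h' (h'' t) t) {m : ℝ} (hm : ∀ t ∈ Set.Icc (0 : ℝ) 1, h'' t ≤ m) :
    h 1 ≤ h 0 + h' 0 + m / 2 := by
  have := taylor_lower (fun t => (hd t).neg) (fun t => (hd' t).neg) (m := -m)
    (fun t ht => neg_le_neg (hm t ht))
  simp only [Pi.neg_apply] at this
  linarith

variable {d n : ℕ}

/-- The quadratic form of the Hessian of the graduated objective at `w`, evaluated at `z`. -/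
def hessianForm (x : Fin n → EuclideanSpace ℝ (Fin d)) (wstar : EuclideanSpace ℝ (Fin d)) (τ : ℝ)
    (w z : EuclideanSpace ℝ (Fin d)) : ℝ :=
  (1 / (n : ℝ)) * ∑ i, 2 * τ ^ 2 *
    (curvature (τ * inner ℝ (x i) w) (τ * inner ℝ (x i) wstar) * inner ℝ (x i) z ^ 2)

lemma gradLabel_noiselessLabel (x : Fin n → EuclideanSpace ℝ (Fin d))
    (wstar : EuclideanSpace ℝ (Fin d)) (τ : ℝ) (i : Fin n) :
    gradLabel τ (noiselessLabel x wstar i) = Real.sigmoid (τ * inner ℝ (x i) wstar) := by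
  unfold gradLabel noiselessLabel gradSigmoid
  rw [Function.leftInverse_invFun Real.sigmoid_injective]

lemma gradObjective_eq (x : Fin n → EuclideanSpace ℝ (Fin d))
    (wstar : EuclideanSpace ℝ (Fin d)) (τ : ℝ) :
    gradObjective x (noiselessLabel x wstar) τ = fun w => (1 / (n : ℝ)) *
      ∑ i, (Real.sigmoid (τ * inner ℝ (x i) wstar) - Real.sigmoid (τ * inner ℝ (x i) w)) ^ 2 := by
  funext w
  simp only [gradObjective, gradLabel_noiselessLabel, gradSigmoid]

lemma hasDerivAt_sq_sigmoid_line (c τ α β t : ℝ) :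
    HasDerivAt (fun t => (c - Real.sigmoid (τ * (α + t * β))) ^ 2)
      (2 * τ * β * ((Real.sigmoid (τ * (α + t * β)) - c) *
        (Real.sigmoid (τ * (α + t * β)) * (1 - Real.sigmoid (τ * (α + t * β)))))) t := by
  have h0 : HasDerivAt (fun t => τ * (α + t * β)) (τ * β) t := by
    simpa using (((hasDerivAt_id t).mul_const β).const_add α).const_mul τ
  have h1 := (((Real.hasDerivAt_sigmoid _).comp t h0).const_sub c).pow 2
  refine h1.congr_deriv ?_
  simp only [Function.comp_apply]
  push_cast
  ring

lemma hasDerivAt_deriv_sq_sigmoid_line (b τ α β t : ℝ) :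
    HasDerivAt (fun t => 2 * τ * β * ((Real.sigmoid (τ * (α + t * β)) - Real.sigmoid b) *
        (Real.sigmoid (τ * (α + t * β)) * (1 - Real.sigmoid (τ * (α + t * β))))))
      (2 * τ ^ 2 * (curvature (τ * (α + t * β)) b * β ^ 2)) t := by
  have h0 : HasDerivAt (fun t => τ * (α + t * β)) (τ * β) t := by
    simpa using (((hasDerivAt_id t).mul_const β).const_add α).const_mul τ
  have h1 := (Real.hasDerivAt_sigmoid _).comp t h0
  have h2 := ((h1.sub_const (Real.sigmoid b)).mul (h1.mul (h1.const_sub 1))).const_mul (2 * τ * β)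
  refine h2.congr_deriv ?_
  simp only [Function.comp_apply, curvature, Pi.mul_apply]
  ring

lemma gradObjective_segment (x : Fin n → EuclideanSpace ℝ (Fin d))
    (wstar : EuclideanSpace ℝ (Fin d)) (τ : ℝ) (u v : EuclideanSpace ℝ (Fin d)) :
    ∃ h h' : ℝ → ℝ, (∀ t, HasDerivAt h (h' t) t) ∧
      (∀ t, HasDerivAt h' (hessianForm x wstar τ (u + t • (v - u)) (v - u)) t) ∧
      h 0 = gradObjective x (noiselessLabel x wstar) τ u ∧
      h 1 = gradObjective x (noiselessLabel x wstar) τ v ∧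
      h' 0 = inner ℝ (gradient (gradObjective x (noiselessLabel x wstar) τ) u) (v - u) := by
  set f := gradObjective x (noiselessLabel x wstar) τ with hf
  have hfe : f = _ := gradObjective_eq x wstar τ
  set h' : ℝ → ℝ := fun t => (1 / (n : ℝ)) * ∑ i, 2 * τ * inner ℝ (x i) (v - u) *
    ((Real.sigmoid (τ * (inner ℝ (x i) u + t * inner ℝ (x i) (v - u))) -
        Real.sigmoid (τ * inner ℝ (x i) wstar)) *
      (Real.sigmoid (τ * (inner ℝ (x i) u + t * inner ℝ (x i) (v - u))) *
        (1 - Real.sigmoid (τ * (inner ℝ (x i) u + t * inner ℝ (x i) (v - u)))))) with hh'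
  have hd : ∀ t, HasDerivAt (fun t : ℝ => f (u + t • (v - u))) (h' t) t := by
    intro t
    have := (HasDerivAt.fun_sum (u := Finset.univ) (fun i _ => hasDerivAt_sq_sigmoid_line
      (Real.sigmoid (τ * inner ℝ (x i) wstar)) τ (inner ℝ (x i) u) (inner ℝ (x i) (v - u)) t)).const_mul
        (1 / (n : ℝ))
    rw [hfe]
    simpa only [inner_add_right, real_inner_smul_right] using this
  refine ⟨fun t => f (u + t • (v - u)), h', hd, fun t => ?_, by simp, by simp, ?_⟩
  · have := (HasDerivAt.fun_sum (u := Finset.univ) (fun i _ => hasDerivAt_deriv_sq_sigmoid_line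
      (τ * inner ℝ (x i) wstar) τ (inner ℝ (x i) u) (inner ℝ (x i) (v - u)) t)).const_mul
        (1 / (n : ℝ))
    simpa only [hessianForm, inner_add_right, real_inner_smul_right] using this
  · have hdf : Differentiable ℝ f := by
      rw [hfe]
      have hi : ∀ i, Differentiable ℝ fun w => inner ℝ (x i) w :=
        fun i => (innerSL ℝ (x i)).differentiable
      exact (Differentiable.fun_sum fun i _ => ((differentiable_const _).sub
        (differentiable_sigmoid.comp ((hi i).const_mul τ))).pow 2).const_mul _
    have hl : HasDerivAt (fun t : ℝ => u + t • (v - u)) (v - u) 0 := by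
      simpa using ((hasDerivAt_id (0 : ℝ)).smul_const (v - u)).const_add u
    have h1 := (hdf (u + (0 : ℝ) • (v - u))).hasFDerivAt.comp_hasDerivAt (0 : ℝ) hl
    -- The explicit derivative along the segment and the one from the chain rule agree by
    -- uniqueness, so the gradient need not be computed.
    have h2 := (hd 0).unique h1
    rw [h2]
    simp only [zero_smul, add_zero]
    rw [gradient, InnerProductSpace.toDual_symm_apply]

lemma stronglyConvexWithin_of_hessianForm (x : Fin n → EuclideanSpace ℝ (Fin d))
    (wstar : EuclideanSpace ℝ (Fin d)) (τ : ℝ) {s : Set (EuclideanSpace ℝ (Fin d))}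
    (hs : Convex ℝ s) {lam : ℝ}
    (H : ∀ w ∈ s, ∀ z, lam * ‖z‖ ^ 2 ≤ hessianForm x wstar τ w z) :
    StronglyConvexWithin (gradObjective x (noiselessLabel x wstar) τ) s lam := by
  intro u hu v hv
  obtain ⟨h, h', hd, hd', e0, e1, eg⟩ := gradObjective_segment x wstar τ u v
  have := taylor_lower hd hd' (m := lam * ‖v - u‖ ^ 2)
    (fun t ht => H _ (hs.add_smul_sub_mem hu hv ht) _)
  rw [← e0, ← e1, ← eg, norm_sub_rev u v]
  linarith

lemma stronglySmoothWithin_of_hessianForm (x : Fin n → EuclideanSpace ℝ (Fin d))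
    (wstar : EuclideanSpace ℝ (Fin d)) (τ : ℝ) {s : Set (EuclideanSpace ℝ (Fin d))}
    (hs : Convex ℝ s) {Lam : ℝ}
    (H : ∀ w ∈ s, ∀ z, hessianForm x wstar τ w z ≤ Lam * ‖z‖ ^ 2) :
    StronglySmoothWithin (gradObjective x (noiselessLabel x wstar) τ) s Lam := by
  intro u hu v hv
  obtain ⟨h, h', hd, hd', e0, e1, eg⟩ := gradObjective_segment x wstar τ u v
  have := taylor_upper hd hd' (m := Lam * ‖v - u‖ ^ 2)
    (fun t ht => H _ (hs.add_smul_sub_mem hu hv ht) _)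
  rw [← e0, ← e1, ← eg, norm_sub_rev u v]
  linarith

/-! ### One-dimensional Gaussian integrals -/

/-- Exponential tilting: a Gaussian weight turns N(0,1) into √v times N(0,v). It is used with v < 1
for the curvature and with v = 2 for exponential moments of the square. -/
lemma gaussianPDFReal_mul_exp (v : NNReal) (hv : v ≠ 0) (x : ℝ) :
    gaussianPDFReal 0 1 x * Real.exp (-((1 / v - 1) / 2 * x ^ 2)) =
      √v * gaussianPDFReal 0 v x := by
  have hv' : (0 : ℝ) < v := by positivity
  rw [gaussianPDFReal, gaussianPDFReal, mul_assoc, ← Real.exp_add,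
    Real.sqrt_mul (by positivity) (v : ℝ)]
  have e : -(x - 0) ^ 2 / (2 * ((1 : NNReal) : ℝ)) + -((1 / v - 1) / 2 * x ^ 2) =
      -(x - 0) ^ 2 / (2 * v) := by
    push_cast
    field_simp
    ring
  rw [e]
  have h1 : √(v : ℝ) ≠ 0 := (Real.sqrt_pos.2 hv').ne'
  simp
  field_simp

lemma integral_mul_exp_gaussianReal (v : NNReal) (hv : v ≠ 0) (f : ℝ → ℝ) :
    ∫ x, f x * Real.exp (-((1 / v - 1) / 2 * x ^ 2)) ∂gaussianReal 0 1 =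
      √v * ∫ x, f x ∂gaussianReal 0 v := by
  rw [integral_gaussianReal_eq_integral_smul one_ne_zero, integral_gaussianReal_eq_integral_smul hv,
    ← integral_const_mul]
  congr 1
  funext x
  simp only [smul_eq_mul]
  have := gaussianPDFReal_mul_exp v hv x
  linear_combination f x * this

lemma integral_exp_sq_div_four_gaussianReal :
    ∫ x, Real.exp (x ^ 2 / 4) ∂gaussianReal 0 1 = √2 := by
  have := integral_mul_exp_gaussianReal 2 two_ne_zero (fun _ => 1)
  simp only [integral_const, probReal_univ, smul_eq_mul, mul_one, one_mul, NNReal.coe_ofNat] at this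
  rw [← this]
  congr 1
  funext x
  congr 1
  ring

lemma integrable_exp_sq_div_four_gaussianReal :
    Integrable (fun x => Real.exp (x ^ 2 / 4)) (gaussianReal 0 1) := by
  -- A non-integrable function has integral 0 by convention, which contradicts the value √2.
  by_contra h
  have := integral_exp_sq_div_four_gaussianReal
  rw [integral_undef h] at this
  exact (Real.sqrt_pos.2 (zero_lt_two' ℝ)).ne this

lemma integral_sq_gaussianReal (v : NNReal) : ∫ x, x ^ 2 ∂gaussianReal 0 v = v := by
  have h := variance_id_gaussianReal (μ := 0) (v := v)
  rw [variance_of_integral_eq_zero (by fun_prop) (by simp)] at h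
  simpa using h

lemma integral_pow_four_gaussianReal : ∫ x, x ^ 4 ∂gaussianReal 0 1 = 3 := by
  have h := iteratedDeriv_mgf_zero (X := fun x : ℝ => x) (μ := gaussianReal 0 1) (by simp) 4
  have e : mgf (fun x : ℝ => x) (gaussianReal 0 1) = fun t => Real.exp (t ^ 2 / 2) := by
    rw [mgf_fun_id_gaussianReal]
    simp
  have he : ∀ t, HasDerivAt (fun t : ℝ => Real.exp (t ^ 2 / 2)) (t * Real.exp (t ^ 2 / 2)) t := by
    intro t
    refine (((hasDerivAt_pow 2 t).div_const 2).exp).congr_deriv ?_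
    push_cast
    ring
  have hp : ∀ (p p' : ℝ → ℝ), (∀ t, HasDerivAt p (p' t) t) →
      deriv (fun t => p t * Real.exp (t ^ 2 / 2)) =
        fun t => (p' t + p t * t) * Real.exp (t ^ 2 / 2) := by
    intro p p' hpp
    funext t
    rw [((hpp t).fun_mul (he t)).deriv]
    ring
  have d1 : deriv (fun t : ℝ => Real.exp (t ^ 2 / 2)) = fun t => t * Real.exp (t ^ 2 / 2) := by
    funext t
    exact (he t).deriv
  have d2 := hp (fun t => t) (fun _ => 1) (fun t => hasDerivAt_id t)
  have d3 := hp (fun t => 1 + t * t) (fun t => 2 * t) (fun t => by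
    refine (((hasDerivAt_id t).mul (hasDerivAt_id t)).const_add 1).congr_deriv ?_
    simp only [id]
    ring)
  have d4 := hp (fun t => 2 * t + (1 + t * t) * t) (fun t => 3 + 3 * t ^ 2) (fun t => by
    refine (((hasDerivAt_id t).const_mul 2).add
      ((((hasDerivAt_id t).mul (hasDerivAt_id t)).const_add 1).mul
        (hasDerivAt_id t))).congr_deriv ?_
    simp only [id, Pi.mul_apply]
    ring)
  rw [e, iteratedDeriv_succ, iteratedDeriv_succ, iteratedDeriv_succ, iteratedDeriv_one, d1, d2, d3,
    d4] at h
  simpa using h.symm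

-- Expected curvature under the standard Gaussian

local notation "V" => EuclideanSpace ℝ (Fin d)

lemma memLp_inner_stdGaussian (w : V) (p : ENNReal) (hp : p ≠ ⊤) :
    MemLp (fun x : V => inner ℝ x w) p (stdGaussian V) := by
  have := IsGaussian.memLp_dual (stdGaussian V) (innerSL ℝ w) p hp
  simpa [real_inner_comm] using this

lemma map_inner_stdGaussian (e : V) (he : ‖e‖ = 1) :
    (stdGaussian V).map (fun x => inner ℝ x e) = gaussianReal 0 1 := by
  have h := IsGaussian.map_eq_gaussianReal (μ := stdGaussian V) (innerSL ℝ e)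
  rw [variance_dual_stdGaussian, integral_strongDual_stdGaussian, innerSL_apply_norm, he] at h
  have e1 : (fun x : V => inner ℝ x e) = innerSL ℝ e := by
    funext x
    rw [innerSL_apply_apply, real_inner_comm]
  rw [e1, h]
  simp

lemma integral_inner_stdGaussian_comp (e : V) (he : ‖e‖ = 1) {f : ℝ → ℝ} (hf : Measurable f) :
    ∫ x, f (inner ℝ x e) ∂stdGaussian V = ∫ x, f x ∂gaussianReal 0 1 := by
  rw [← map_inner_stdGaussian e he, integral_map (by fun_prop) hf.aestronglyMeasurable]

lemma integrable_inner_stdGaussian_comp (e : V) (he : ‖e‖ = 1) {f : ℝ → ℝ} (hf : Measurable f)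
    (hi : Integrable f (gaussianReal 0 1)) :
    Integrable (fun x => f (inner ℝ x e)) (stdGaussian V) := by
  rw [← map_inner_stdGaussian e he, integrable_map_measure hf.aestronglyMeasurable (by fun_prop)]
    at hi
  exact hi

lemma integral_inner_stdGaussian (w : V) : ∫ x, inner ℝ x w ∂stdGaussian V = 0 := by
  simpa [real_inner_comm] using integral_strongDual_stdGaussian (E := V) (innerSL ℝ w)

lemma integral_inner_sq_stdGaussian (w : V) :
    ∫ x, inner ℝ x w ^ 2 ∂stdGaussian V = ‖w‖ ^ 2 := by
  have h := variance_dual_stdGaussian (E := V) (innerSL ℝ w)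
  rw [variance_of_integral_eq_zero (by fun_prop) (integral_strongDual_stdGaussian _),
    innerSL_apply_norm] at h
  simpa [real_inner_comm] using h

lemma indepFun_inner_stdGaussian (e f : V) (h : inner ℝ e f = 0) :
    IndepFun (fun x : V => inner ℝ x e) (fun x => inner ℝ x f) (stdGaussian V) := by
  apply HasGaussianLaw.indepFun_of_covariance_eq_zero
  · constructor
    have : (fun x : V => ((inner ℝ x e : ℝ), (inner ℝ x f : ℝ))) =
        (innerSL ℝ e).prod (innerSL ℝ f) := by
      funext x
      simp [real_inner_comm]
    rw [this]
    infer_instance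
  · simp_rw [fun (x y : V) => real_inner_comm y x]
    rw [← covarianceBilin_apply_eq_cov IsGaussian.memLp_two_id, covarianceBilin_stdGaussian]
    exact h

/-- The vector z only supplies a direction when p = 0. -/
lemma exists_unit_smul (p z : V) (hz : ‖z‖ = 1) : ∃ e : V, ‖e‖ = 1 ∧ p = ‖p‖ • e := by
  by_cases hp : p = 0
  · exact ⟨z, hz, by simp [hp]⟩
  · have : ‖p‖ ≠ 0 := norm_ne_zero_iff.2 hp
    exact ⟨‖p‖⁻¹ • p, by rw [norm_smul, norm_inv, norm_norm, inv_mul_cancel₀ this],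
      by rw [smul_smul, mul_inv_cancel₀ this, one_smul]⟩

/-- With p = ‖p‖e and z = ce + z', z' ⊥ e, the variables ⟨x,e⟩ and ⟨x,z'⟩ are independent. The
weight shrinks the variance along e to v and leaves z' alone, so the integral is √v(vc² + ‖z'‖²),
where c² + ‖z'‖² = 1 and v ≤ 1. -/
lemma integral_exp_neg_sq_mul_inner_sq_ge (p z : V) (hz : ‖z‖ = 1) {v : ℝ}
    (hv : v = 1 / (1 + ‖p‖ ^ 2)) :
    √v * v ≤ ∫ x, Real.exp (-(inner ℝ x p ^ 2 / 2)) * inner ℝ x z ^ 2 ∂stdGaussian V := by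
  obtain ⟨e, he, hpe⟩ := exists_unit_smul p z hz
  have hv0 : 0 < v := by rw [hv]; positivity
  have hv1 : v ≤ 1 := by
    rw [hv, div_le_one (by positivity)]
    nlinarith [sq_nonneg ‖p‖]
  lift v to NNReal using hv0.le
  have hvn : v ≠ 0 := by rintro rfl; simp at hv0
  set c : ℝ := inner ℝ z e with hc
  set z' : V := z - c • e with hz'
  have hee : inner ℝ e e = (1 : ℝ) := by rw [real_inner_self_eq_norm_sq, he]; norm_num
  have horth : inner ℝ e z' = 0 := by
    rw [hz', inner_sub_right, real_inner_smul_right, hee, hc, real_inner_comm]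
    ring
  have hnorm : c ^ 2 + ‖z'‖ ^ 2 = 1 := by
    rw [← real_inner_self_eq_norm_sq z', hz']
    simp only [inner_sub_left, inner_sub_right, real_inner_smul_left, real_inner_smul_right, hee,
      real_inner_self_eq_norm_sq z, hz, real_inner_comm z e]
    rw [← hc]
    ring
  have hzz : ∀ x : V, inner ℝ x z = c * inner ℝ x e + inner ℝ x z' := by
    intro x
    rw [hz', inner_sub_right, real_inner_smul_right]
    ring
  set φ : ℝ → ℝ := fun t => Real.exp (-((1 / v - 1) / 2 * t ^ 2)) with hφ
  have hφm : Measurable φ := by fun_prop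
  have hφe : ∀ x : V, Real.exp (-(inner ℝ x p ^ 2 / 2)) = φ (inner ℝ x e) := by
    intro x
    rw [hφ]
    simp only
    congr 2
    conv_lhs => rw [hpe]
    rw [real_inner_smul_right, hv]
    field_simp
    ring
  have hφ0 : ∀ t, 0 ≤ φ t := fun t => (Real.exp_pos _).le
  have hφ1 : ∀ t, φ t ≤ 1 := fun t => by
    rw [hφ]
    simp only [Real.exp_le_one_iff, Left.neg_nonpos_iff]
    have : (1 : ℝ) ≤ 1 / v := by rw [le_div_iff₀ hv0]; linarith
    have : 0 ≤ (1 / (v : ℝ) - 1) / 2 := by linarith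
    positivity
  have hbd : ∀ {g : V → ℝ}, Integrable g (stdGaussian V) →
      Integrable (fun x => φ (inner ℝ x e) * g x) (stdGaussian V) := fun hg => by
    refine hg.bdd_mul (c := 1) ?_ (ae_of_all _ fun x => ?_)
    · exact (hφm.comp (by fun_prop)).aestronglyMeasurable
    · rw [Real.norm_eq_abs, abs_of_nonneg (hφ0 _)]
      exact hφ1 _
  have i1 := (memLp_inner_stdGaussian e 2 (by norm_num)).integrable_sq
  have i2 := (memLp_inner_stdGaussian z' 2 (by norm_num)).integrable_sq
  have i3 := (memLp_inner_stdGaussian e 2 (by norm_num)).integrable_mul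
    (memLp_inner_stdGaussian z' 2 (by norm_num))
  have hind := indepFun_inner_stdGaussian e z' horth
  have E1 : ∫ x : V, φ (inner ℝ x e) * inner ℝ x e ^ 2 ∂stdGaussian V = √v * v := by
    rw [integral_inner_stdGaussian_comp e he (f := fun t => φ t * t ^ 2) (by fun_prop)]
    simp_rw [mul_comm (φ _)]
    rw [integral_mul_exp_gaussianReal v hvn, integral_sq_gaussianReal]
  have E0 : ∫ x : V, φ (inner ℝ x e) ∂stdGaussian V = √v := by
    rw [integral_inner_stdGaussian_comp e he hφm]
    have := integral_mul_exp_gaussianReal v hvn (fun _ => 1)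
    simpa [hφ] using this
  have E2 : ∫ x : V, φ (inner ℝ x e) * inner ℝ x z' ^ 2 ∂stdGaussian V = √v * ‖z'‖ ^ 2 := by
    have h := (hind.comp (φ := φ) (ψ := fun t => t ^ 2) hφm
      (by fun_prop)).integral_fun_mul_eq_mul_integral
      (hφm.comp (by fun_prop)).aestronglyMeasurable (by fun_prop)
    simp only [Function.comp_apply] at h
    rw [h, E0, integral_inner_sq_stdGaussian]
  have E3 : ∫ x : V, φ (inner ℝ x e) * (inner ℝ x e * inner ℝ x z') ∂stdGaussian V = 0 := by
    have h := (hind.comp (φ := fun t => φ t * t) (ψ := fun t => t) (by fun_prop)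
      (by fun_prop)).integral_fun_mul_eq_mul_integral
      (Measurable.aestronglyMeasurable (by
        simp only [Function.comp_def]
        exact (hφm.comp (by fun_prop)).mul (by fun_prop))) (by fun_prop)
    simp only [Function.comp_apply] at h
    simp_rw [← mul_assoc]
    rw [h, integral_inner_stdGaussian, mul_zero]
  have key : ∫ x, Real.exp (-(inner ℝ x p ^ 2 / 2)) * inner ℝ x z ^ 2 ∂stdGaussian V =
      c ^ 2 * (√v * v) + 2 * c * 0 + √v * ‖z'‖ ^ 2 := by
    rw [← E1, ← E2, ← E3, ← integral_const_mul, ← integral_const_mul, ← integral_add,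
      ← integral_add]
    · congr 1
      funext x
      rw [hφe, hzz]
      ring
    · exact ((hbd i1).const_mul _).add ((hbd i3).const_mul _)
    · exact hbd i2
    · exact (hbd i1).const_mul _
    · exact (hbd i3).const_mul _
  rw [key]
  have hs : 0 ≤ √(v : ℝ) := Real.sqrt_nonneg _
  have : √(v : ℝ) * v * ‖z'‖ ^ 2 ≤ √v * ‖z'‖ ^ 2 := by
    have := mul_le_of_le_one_right hs hv1
    gcongr
  have h1 : √(v : ℝ) * v * (c ^ 2 + ‖z'‖ ^ 2) = √v * v := by rw [hnorm, mul_one]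
  linarith

lemma integrable_inner_pow_four (e : V) :
    Integrable (fun x => inner ℝ x e ^ 4) (stdGaussian V) := by
  have := (memLp_inner_stdGaussian e 4 (by norm_num)).integrable_norm_pow (p := 4) (by norm_num)
  simpa [Even.pow_abs (show Even 4 by decide)] using this

lemma integral_inner_pow_four (e : V) (he : ‖e‖ = 1) :
    ∫ x, inner ℝ x e ^ 4 ∂stdGaussian V = 3 := by
  rw [integral_inner_stdGaussian_comp e he (f := fun t => t ^ 4) (by fun_prop),
    integral_pow_four_gaussianReal]

/-- A linearized Cauchy–Schwarz: |s| ≤ 7/8 + 2s²/7 and s²t² ≤ (s⁴+t⁴)/2. With fourth moments 3 the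
expectation is 7/8 + 6/7 < 7/4, without any joint law. -/
lemma abs_mul_sq_le (s t : ℝ) :
    |s| * t ^ 2 ≤ 7 / 8 * t ^ 2 + 1 / 7 * (s ^ 4 + t ^ 4) := by
  have h1 : |s| ≤ 7 / 8 + 2 / 7 * s ^ 2 := by
    nlinarith [sq_nonneg (|s| - 7 / 4), sq_abs s]
  have h2 := mul_le_mul_of_nonneg_right h1 (sq_nonneg t)
  nlinarith [sq_nonneg (s ^ 2 - t ^ 2)]

lemma integrable_abs_inner_mul_inner_sq (u z : V) :
    Integrable (fun x => |inner ℝ x u| * inner ℝ x z ^ 2) (stdGaussian V) := by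
  have i2 := (memLp_inner_stdGaussian z 2 (by norm_num)).integrable_sq
  refine ((i2.const_mul (7 / 8)).add (((integrable_inner_pow_four u).add
    (integrable_inner_pow_four z)).const_mul (1 / 7))).mono' (by fun_prop)
    (ae_of_all _ fun x => ?_)
  rw [Real.norm_eq_abs, abs_of_nonneg (by positivity)]
  exact abs_mul_sq_le _ _

lemma integral_abs_inner_mul_inner_sq_le (u z : V) (hz : ‖z‖ = 1) :
    ∫ x, |inner ℝ x u| * inner ℝ x z ^ 2 ∂stdGaussian V ≤ 7 / 4 * ‖u‖ := by
  obtain ⟨e, he, hue⟩ := exists_unit_smul u z hz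
  have i2 := (memLp_inner_stdGaussian z 2 (by norm_num)).integrable_sq
  have h1 : ∫ x, |inner ℝ x e| * inner ℝ x z ^ 2 ∂stdGaussian V ≤ 7 / 4 := by
    calc _ ≤ ∫ x, (7 / 8 * inner ℝ x z ^ 2 + 1 / 7 * (inner ℝ x e ^ 4 + inner ℝ x z ^ 4))
          ∂stdGaussian V := by
          refine integral_mono (integrable_abs_inner_mul_inner_sq e z) ?_
            (fun x => abs_mul_sq_le _ _)
          exact (i2.const_mul (7 / 8)).add (((integrable_inner_pow_four e).add
            (integrable_inner_pow_four z)).const_mul (1 / 7))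
      _ = 7 / 8 * ‖z‖ ^ 2 + 1 / 7 * (3 + 3) := by
          rw [integral_add (i2.const_mul _) (((integrable_inner_pow_four e).fun_add
            (integrable_inner_pow_four z)).const_mul _), integral_const_mul, integral_const_mul,
            integral_add (integrable_inner_pow_four e) (integrable_inner_pow_four z),
            integral_inner_pow_four e he, integral_inner_pow_four z hz,
            integral_inner_sq_stdGaussian]
      _ ≤ 7 / 4 := by rw [hz]; norm_num
  have h2 : ∀ x : V, |inner ℝ x u| * inner ℝ x z ^ 2 =
      ‖u‖ * (|inner ℝ x e| * inner ℝ x z ^ 2) := by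
    intro x
    conv_lhs => rw [hue]
    rw [real_inner_smul_right, abs_mul, abs_norm, mul_assoc]
  simp_rw [h2]
  rw [integral_const_mul]
  nlinarith [norm_nonneg u]

lemma integrable_curvature_mul (p q z : V) :
    Integrable (fun x => curvature (inner ℝ x p) (inner ℝ x q) * inner ℝ x z ^ 2)
      (stdGaussian V) := by
  have i2 := (memLp_inner_stdGaussian z 2 (by norm_num)).integrable_sq
  refine i2.bdd_mul (c := 13 / 80) ?_ (ae_of_all _ fun x => abs_curvature_le _ _)
  exact (continuous_curvature.measurable.comp
    (by fun_prop : Measurable fun x : V => (inner ℝ x p, inner ℝ x q))).aestronglyMeasurable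

lemma integral_curvature_ge_of_norm_eq_one (p u z : V) (hz : ‖z‖ = 1) {v : ℝ}
    (hv : v = 1 / (1 + ‖p‖ ^ 2)) :
    1 / 16 * (√v * v) - 7 / 160 * ‖u‖ ≤
      ∫ x, curvature (inner ℝ x p) (inner ℝ x (p - u)) * inner ℝ x z ^ 2 ∂stdGaussian V := by
  have i2 := (memLp_inner_stdGaussian z 2 (by norm_num)).integrable_sq
  have i3 := integrable_abs_inner_mul_inner_sq u z
  have i1 : Integrable (fun x : V => Real.exp (-(inner ℝ x p ^ 2 / 2)) * inner ℝ x z ^ 2)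
      (stdGaussian V) := by
    refine i2.bdd_mul (c := 1) (Measurable.aestronglyMeasurable (by fun_prop))
      (ae_of_all _ fun x => ?_)
    rw [Real.norm_eq_abs, abs_of_pos (Real.exp_pos _), Real.exp_le_one_iff]
    linarith [sq_nonneg (inner ℝ x p : ℝ)]
  calc _ ≤ 1 / 16 * (∫ x, Real.exp (-(inner ℝ x p ^ 2 / 2)) * inner ℝ x z ^ 2 ∂stdGaussian V) -
        1 / 40 * ∫ x, |inner ℝ x u| * inner ℝ x z ^ 2 ∂stdGaussian V := by
        have h1 := integral_exp_neg_sq_mul_inner_sq_ge p z hz hv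
        have h2 := integral_abs_inner_mul_inner_sq_le u z hz
        linarith
    _ = ∫ x, (1 / 16 * (Real.exp (-(inner ℝ x p ^ 2 / 2)) * inner ℝ x z ^ 2) -
        1 / 40 * (|inner ℝ x u| * inner ℝ x z ^ 2)) ∂stdGaussian V := by
        rw [← integral_const_mul, ← integral_const_mul,
          ← integral_sub (i1.const_mul _) (i3.const_mul _)]
    _ ≤ _ := by
        refine integral_mono ((i1.const_mul _).sub (i3.const_mul _))
          (integrable_curvature_mul p (p - u) z) fun x => ?_
        have h := curvature_ge (inner ℝ x p) (inner ℝ x (p - u))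
        rw [inner_sub_right, sub_sub_cancel] at h
        have := mul_le_mul_of_nonneg_right h (sq_nonneg (inner ℝ x z : ℝ))
        rw [inner_sub_right]
        linarith

lemma one_add_sq_pow_three_le {s : ℝ} (hs : 0 ≤ s) :
    (1 + s ^ 2) ^ 3 ≤ 4 * Real.exp (2 * s) := by
  set x := 2 * s / 3 with hx
  have hx0 : 0 ≤ x := by positivity
  have h := Real.sum_le_exp_of_nonneg hx0 5
  simp only [Finset.sum_range_succ, Finset.sum_range_zero, Nat.factorial] at h
  norm_num at h
  -- Cube root of the claim, proved with the quartic Taylor polynomial of exp; 1.58³ < 4.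
  have h1 : 1 + s ^ 2 ≤ 1.58 * Real.exp x := by
    have hsx : s = 3 / 2 * x := by rw [hx]; ring
    rw [hsx]
    have h3 : 0 ≤ 0.58 + 1.58 * x - 1.46 * x ^ 2 + 0.263 * x ^ 3 + 0.065 * x ^ 4 := by
      nlinarith [mul_nonneg hx0 (sq_nonneg (x - 2)), sq_nonneg (x * (x - 2)),
        sq_nonneg (x - 1), sq_nonneg (x ^ 2 - 3), sq_nonneg (x - 2)]
    nlinarith [pow_nonneg hx0 3, pow_nonneg hx0 4]
  calc (1 + s ^ 2) ^ 3 ≤ (1.58 * Real.exp x) ^ 3 := by gcongr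
    _ = 1.58 ^ 3 * Real.exp (2 * s) := by
        rw [mul_pow, ← Real.exp_nat_mul, hx]
        congr 2
        push_cast
        ring
    _ ≤ 4 * Real.exp (2 * s) := by
        gcongr
        norm_num

lemma sqrt_mul_self_ge {s : ℝ} (hs : 0 ≤ s) {v : ℝ} (hv : v = 1 / (1 + s ^ 2)) :
    Real.exp (-s) / 2 ≤ √v * v := by
  have hv0 : 0 < v := by rw [hv]; positivity
  have h := one_add_sq_pow_three_le hs
  have h1 : (Real.exp (-s) / 2) ^ 2 ≤ (√v * v) ^ 2 := by
    rw [mul_pow, Real.sq_sqrt hv0.le, div_pow, ← Real.exp_nat_mul,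
      show v * v ^ 2 = v ^ 3 by ring, hv, div_pow, one_pow,
      show ((2 : ℕ) : ℝ) * -s = -(2 * s) by push_cast; ring, Real.exp_neg]
    rw [← one_div, div_div]
    refine one_div_le_one_div_of_le (by positivity) ?_
    linarith
  exact le_of_pow_le_pow_left₀ two_ne_zero (by positivity) h1

/-- The main term is at least 7/10 · e^{-τR}/32, as e^{-1/3} ≥ 7/10; the error is at most 7/160 ·
e^{-R}/3 ≤ 7/480 · e^{-τR}. The difference 7/960 exceeds 1/200. -/
lemma integral_curvature_ge {R τ : ℝ} (hR : 0 ≤ R) (hτ1 : τ ≤ 1) (p u z : V)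
    (hp : ‖p‖ ≤ τ * R + 1 / 3) (hu : ‖u‖ ≤ Real.exp (-R) / 3) :
    1 / 200 * Real.exp (-(τ * R)) * ‖z‖ ^ 2 ≤
      ∫ x, curvature (inner ℝ x p) (inner ℝ x (p - u)) * inner ℝ x z ^ 2 ∂stdGaussian V := by
  by_cases hz0 : z = 0
  · simp [hz0]
  have hzn : ‖z‖ ≠ 0 := norm_ne_zero_iff.2 hz0
  obtain ⟨e, he, hze⟩ := exists_unit_smul z (‖z‖⁻¹ • z)
    (by rw [norm_smul, norm_inv, norm_norm, inv_mul_cancel₀ hzn])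
  have h1 := integral_curvature_ge_of_norm_eq_one p u e he rfl
  have h2 := sqrt_mul_self_ge (norm_nonneg p) rfl
  have h3 : Real.exp (-(τ * R)) * (7 / 10) ≤ Real.exp (-‖p‖) := by
    calc Real.exp (-(τ * R)) * (7 / 10) ≤ Real.exp (-(τ * R)) * Real.exp (-(1 / 3)) := by
          gcongr
          rw [Real.exp_neg, ← one_div, le_div_iff₀ (Real.exp_pos _)]
          have : Real.exp (1 / 3) ≤ 10 / 7 := by
            refine le_of_pow_le_pow_left₀ (n := 3) (by norm_num) (by norm_num) ?_
            rw [← Real.exp_nat_mul]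
            norm_num
            have := Real.exp_one_lt_d9
            linarith
          linarith
      _ = Real.exp (-(τ * R + 1 / 3)) := by rw [← Real.exp_add]; congr 1; ring
      _ ≤ _ := by gcongr
  have h4 : Real.exp (-R) ≤ Real.exp (-(τ * R)) := by
    apply Real.exp_le_exp.2
    nlinarith
  have h5 : ∀ x : V, curvature (inner ℝ x p) (inner ℝ x (p - u)) * inner ℝ x z ^ 2 =
      ‖z‖ ^ 2 * (curvature (inner ℝ x p) (inner ℝ x (p - u)) * inner ℝ x e ^ 2) := by
    intro x
    conv_lhs => rw [hze]
    rw [real_inner_smul_right]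
    ring
  simp_rw [h5]
  rw [integral_const_mul, mul_comm (‖z‖ ^ 2)]
  gcongr
  linarith [Real.exp_pos (-(τ * R))]

/-! ### Exponential moments and concentration -/

lemma exp_le_one_add_add_sq_mul (t : ℝ) :
    Real.exp t ≤ 1 + t + t ^ 2 * Real.exp |t| := by
  have h1 : 1 ≤ Real.exp |t| := Real.one_le_exp (abs_nonneg t)
  rcases le_or_gt |t| 1 with h | h
  · have := (abs_le.1 (Real.abs_exp_sub_one_sub_id_le h)).2
    nlinarith [sq_nonneg t]
  · rcases lt_abs.1 h with h0 | h0
    · rw [abs_of_pos (by linarith)]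
      nlinarith [mul_nonneg (show 0 ≤ t ^ 2 - 1 by nlinarith) (Real.exp_pos t).le]
    · have : Real.exp t ≤ 1 := Real.exp_le_one_iff.2 (by linarith)
      nlinarith [sq_nonneg t]

lemma integrable_exp_inner_sq_div_four (e : V) (he : ‖e‖ = 1) :
    Integrable (fun x => Real.exp (inner ℝ x e ^ 2 / 4)) (stdGaussian V) :=
  integrable_inner_stdGaussian_comp e he (f := fun t => Real.exp (t ^ 2 / 4)) (by fun_prop)
    integrable_exp_sq_div_four_gaussianReal

lemma integral_exp_inner_sq_div_four_le (e : V) (he : ‖e‖ = 1) :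
    ∫ x, Real.exp (inner ℝ x e ^ 2 / 4) ∂stdGaussian V ≤ 3 / 2 := by
  rw [integral_inner_stdGaussian_comp e he (f := fun t => Real.exp (t ^ 2 / 4)) (by fun_prop),
    integral_exp_sq_div_four_gaussianReal, Real.sqrt_le_left (by norm_num)]
  norm_num

/-- For s ≤ 1/8 the second-order remainder is at most s²t⁴e^{t²/8}, and t⁴ ≤ 128e^{t²/8}. The
resulting e^{t²/4} is Gaussian-integrable. -/
lemma exp_neg_mul_le_of_abs_le_sq {s y t : ℝ} (hs : 0 ≤ s) (hs1 : s ≤ 1 / 8) (hy : |y| ≤ t ^ 2) :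
    Real.exp (-s * y) ≤ 1 - s * y + 128 * s ^ 2 * Real.exp (t ^ 2 / 4) := by
  have h1 := exp_le_one_add_add_sq_mul (-s * y)
  have h2 : |-s * y| ≤ t ^ 2 / 8 := by
    rw [abs_mul, abs_neg, abs_of_nonneg hs]
    nlinarith [abs_nonneg y]
  have h3 : (-s * y) ^ 2 ≤ s ^ 2 * (t ^ 2) ^ 2 := by
    rw [mul_pow, neg_sq]
    refine mul_le_mul_of_nonneg_left ?_ (sq_nonneg s)
    rw [← sq_abs]
    gcongr
  have h4 : (t ^ 2) ^ 2 ≤ 128 * Real.exp (t ^ 2 / 8) := by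
    have := Real.quadratic_le_exp_of_nonneg (show 0 ≤ t ^ 2 / 8 by positivity)
    nlinarith [sq_nonneg t]
  have h5 : (-s * y) ^ 2 * Real.exp |-s * y| ≤
      s ^ 2 * (128 * Real.exp (t ^ 2 / 8)) * Real.exp (t ^ 2 / 8) := by
    refine mul_le_mul (h3.trans (by gcongr)) (by gcongr) (by positivity) (by positivity)
  have h6 : Real.exp (t ^ 2 / 8) * Real.exp (t ^ 2 / 8) = Real.exp (t ^ 2 / 4) := by
    rw [← Real.exp_add]
    congr 1
    ring
  rw [← h6]
  linarith

lemma integrable_of_abs_le_inner_sq {g : V → ℝ} (hg : Measurable g) (e : V)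
    (h : ∀ x, |g x| ≤ inner ℝ x e ^ 2) : Integrable g (stdGaussian V) :=
  (memLp_inner_stdGaussian e 2 (by norm_num)).integrable_sq.mono' hg.aestronglyMeasurable
    (ae_of_all _ h)

lemma integrable_exp_neg_mul {g : V → ℝ} (hg : Measurable g) (e : V) (he : ‖e‖ = 1)
    (h : ∀ x, |g x| ≤ inner ℝ x e ^ 2) {s : ℝ} (hs : 0 ≤ s) (hs1 : s ≤ 1 / 8) :
    Integrable (fun x => Real.exp (-s * g x)) (stdGaussian V) := by
  have hgi := integrable_of_abs_le_inner_sq hg e h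
  refine (((integrable_const 1).sub (hgi.const_mul s)).add
    ((integrable_exp_inner_sq_div_four e he).const_mul (128 * s ^ 2))).mono'
    (Measurable.aestronglyMeasurable (by fun_prop)) (ae_of_all _ fun x => ?_)
  rw [Real.norm_eq_abs, Real.abs_exp]
  exact exp_neg_mul_le_of_abs_le_sq hs hs1 (h x)

lemma integral_exp_neg_mul_le {g : V → ℝ} (hg : Measurable g) (e : V) (he : ‖e‖ = 1)
    (h : ∀ x, |g x| ≤ inner ℝ x e ^ 2) {s : ℝ} (hs : 0 ≤ s) (hs1 : s ≤ 1 / 8) :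
    ∫ x, Real.exp (-s * g x) ∂stdGaussian V ≤
      Real.exp (-s * (∫ x, g x ∂stdGaussian V) + 192 * s ^ 2) := by
  have hgi := integrable_of_abs_le_inner_sq hg e h
  have hei := integrable_exp_inner_sq_div_four e he
  calc ∫ x, Real.exp (-s * g x) ∂stdGaussian V
      ≤ ∫ x, (1 - s * g x + 128 * s ^ 2 * Real.exp (inner ℝ x e ^ 2 / 4)) ∂stdGaussian V :=
        integral_mono (integrable_exp_neg_mul hg e he h hs hs1)
          (((integrable_const 1).sub (hgi.const_mul s)).add (hei.const_mul (128 * s ^ 2)))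
          fun x => exp_neg_mul_le_of_abs_le_sq hs hs1 (h x)
    _ = 1 - s * (∫ x, g x ∂stdGaussian V) +
        128 * s ^ 2 * ∫ x, Real.exp (inner ℝ x e ^ 2 / 4) ∂stdGaussian V := by
        have hsi : Integrable (fun x => 1 - s * g x) (stdGaussian V) :=
          (integrable_const 1).sub (hgi.const_mul s)
        rw [integral_add hsi (hei.const_mul _), integral_sub (integrable_const 1) (hgi.const_mul s),
          integral_const_mul, integral_const_mul]
        simp
    _ ≤ (-s * (∫ x, g x ∂stdGaussian V) + 192 * s ^ 2) + 1 := by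
        have := integral_exp_inner_sq_div_four_le e he
        nlinarith [sq_nonneg s]
    _ ≤ _ := Real.add_one_le_exp _

section Concentration

variable {Ω : Type*} [MeasurableSpace Ω] {P : Measure Ω} [IsProbabilityMeasure P]
  {X : Fin n → Ω → EuclideanSpace ℝ (Fin d)}

lemma measureReal_sum_le_le_exp (hX : iIndepFun X P)
    (hL : ∀ i, HasLaw (X i) (stdGaussian V) P) {g : V → ℝ} (hg : Measurable g) (e : V)
    (he : ‖e‖ = 1) (h : ∀ x, |g x| ≤ inner ℝ x e ^ 2) {ε : ℝ} (hε : 0 ≤ ε) (hε1 : ε ≤ 48) :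
    P.real {ω | ∑ i, g (X i ω) ≤ n * ((∫ x, g x ∂stdGaussian V) - ε)} ≤
      Real.exp (-(ε ^ 2 / 768 * n)) := by
  -- This s minimizes -sε + 192s², with value -ε²/768; ε ≤ 48 is exactly s ≤ 1/8.
  set s := ε / 384 with hs
  have hs0 : 0 ≤ s := by positivity
  have hs1 : s ≤ 1 / 8 := by rw [hs]; linarith
  set Y : Fin n → Ω → ℝ := fun i ω => g (X i ω) with hY
  have hXm : ∀ i, AEMeasurable (X i) P := fun i => (hL i).aemeasurable
  have hYm : ∀ i, AEMeasurable (Y i) P := fun i => hg.comp_aemeasurable (hXm i)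
  have hYind : iIndepFun Y P := hX.comp (fun _ => g) (fun _ => hg)
  have hexp := integrable_exp_neg_mul hg e he h hs0 hs1
  have hmgf : ∀ i, mgf (Y i) P (-s) ≤
      Real.exp (-s * (∫ x, g x ∂stdGaussian V) + 192 * s ^ 2) := by
    intro i
    refine le_trans (le_of_eq ?_) (integral_exp_neg_mul_le hg e he h hs0 hs1)
    exact (hL i).integral_comp (f := fun x => Real.exp (-s * g x)) hexp.aestronglyMeasurable
  have hmpos : ∀ i, 0 < mgf (Y i) P (-s) := by
    intro i
    apply mgf_pos
    have h1 := hexp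
    rw [← (hL i).map_eq] at h1
    exact (integrable_map_measure h1.aestronglyMeasurable (hXm i)).1 h1
  have hsum := hYind.mgf_sum₀ hYm (t := -s) Finset.univ
  -- The moment generating function is 0 by convention where the exponential is not integrable, so
  -- positivity of the product gives integrability.
  have hint : Integrable (fun ω => Real.exp (-s * (∑ i, Y i) ω)) P := by
    rw [← mgf_pos_iff, hsum]
    exact Finset.prod_pos fun i _ => hmpos i
  have hch := measure_le_le_exp_mul_mgf (μ := P) (X := ∑ i, Y i) (t := -s)
    (n * ((∫ x, g x ∂stdGaussian V) - ε)) (by linarith) hint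
  simp only [Finset.sum_apply] at hch
  refine hch.trans ?_
  rw [hsum]
  calc _ ≤ Real.exp (- -s * (n * ((∫ x, g x ∂stdGaussian V) - ε))) *
        ∏ _i : Fin n, Real.exp (-s * (∫ x, g x ∂stdGaussian V) + 192 * s ^ 2) := by
        gcongr with i
        · exact fun i _ => (hmpos i).le
        · exact hmgf i
    _ = Real.exp (-(ε ^ 2 / 768 * n)) := by
        rw [Finset.prod_const, Finset.card_univ, Fintype.card_fin, ← Real.exp_nat_mul,
          ← Real.exp_add]
        congr 1
        rw [hs]
        ring

lemma measureReal_abs_inner_ge_le (hL : ∀ i, HasLaw (X i) (stdGaussian V) P) (i : Fin n) (e : V)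
    (he : ‖e‖ = 1) {B : ℝ} (hB : 0 ≤ B) :
    P.real {ω | B ≤ |inner ℝ (X i ω) e|} ≤ 2 * Real.exp (-(B ^ 2 / 4)) := by
  have hei := integrable_exp_inner_sq_div_four e he
  have hi : Integrable (fun ω => Real.exp (inner ℝ (X i ω) e ^ 2 / 4)) P := by
    have h1 := hei
    rw [← (hL i).map_eq] at h1
    exact (integrable_map_measure h1.aestronglyMeasurable (hL i).aemeasurable).1 h1
  have h1 := mul_meas_ge_le_integral_of_nonneg (ae_of_all _ fun ω => (Real.exp_pos _).le) hi
    (Real.exp (B ^ 2 / 4))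
  have h2 : ∫ ω, Real.exp (inner ℝ (X i ω) e ^ 2 / 4) ∂P ≤ 3 / 2 := by
    refine le_trans (le_of_eq ?_) (integral_exp_inner_sq_div_four_le e he)
    exact (hL i).integral_comp (f := fun x => Real.exp (inner ℝ x e ^ 2 / 4))
      hei.aestronglyMeasurable
  have h3 : P.real {ω | B ≤ |inner ℝ (X i ω) e|} ≤
      P.real {ω | Real.exp (B ^ 2 / 4) ≤ Real.exp (inner ℝ (X i ω) e ^ 2 / 4)} := by
    refine measureReal_mono fun ω hω => ?_
    simp only [Set.mem_ofPred_eq] at hω ⊢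
    apply Real.exp_le_exp.2
    rw [← sq_abs (inner ℝ (X i ω) e)]
    gcongr
  refine h3.trans ?_
  rw [Real.exp_neg, ← div_eq_mul_inv, le_div_iff₀' (Real.exp_pos _)]
  linarith

end Concentration

/-! ### The grid and the sample size -/

/-- The grid points `h • k` with `k` an integer vector with entries in `[-N, N]`. -/
def grid (d : ℕ) (h : ℝ) (N : ℕ) : Finset (EuclideanSpace ℝ (Fin d)) :=
  (Fintype.piFinset fun _ : Fin d => Finset.Icc (-(N : ℤ)) N).image
    fun k => WithLp.toLp 2 fun j => h * (k j : ℝ)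

lemma card_grid_le (h : ℝ) (N : ℕ) : (grid d h N).card ≤ (2 * N + 1) ^ d := by
  refine Finset.card_image_le.trans ?_
  rw [Fintype.card_piFinset]
  simp only [Int.card_Icc, Finset.prod_const, Finset.card_univ, Fintype.card_fin]
  apply le_of_eq
  congr 1
  omega

/-- Rounding toward zero never increases a norm, so grid points inherit the norm constraints needed
for the expected curvature bound. -/
lemma exists_int_round_toward_zero {h : ℝ} (hh : 0 < h) {N : ℕ} {a : ℝ} (ha : |a| ≤ h * N) :
    ∃ k : ℤ, k ∈ Finset.Icc (-(N : ℤ)) N ∧ |h * (k : ℝ)| ≤ |a| ∧ |a - h * k| ≤ h := by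
  have key : ∀ b : ℝ, 0 ≤ b → b ≤ h * N →
      ∃ k : ℤ, 0 ≤ k ∧ k ≤ N ∧ h * (k : ℝ) ≤ b ∧ b - h * k ≤ h := by
    intro b hb hbN
    have h1 := Int.floor_le (b / h)
    have h2 := (Int.lt_floor_add_one (b / h)).le
    rw [le_div_iff₀ hh] at h1
    rw [div_le_iff₀ hh] at h2
    refine ⟨⌊b / h⌋, Int.floor_nonneg.2 (by positivity), ?_, by linarith, by linarith⟩
    have : (⌊b / h⌋ : ℝ) ≤ N := (Int.floor_le _).trans ((div_le_iff₀' hh).2 hbN)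
    exact_mod_cast this
  rcases le_total 0 a with h0 | h0
  · rw [abs_of_nonneg h0] at ha ⊢
    obtain ⟨k, k0, kN, h1, h2⟩ := key a h0 ha
    have hk : (0 : ℝ) ≤ k := by exact_mod_cast k0
    refine ⟨k, Finset.mem_Icc.2 ⟨by omega, kN⟩, ?_, ?_⟩
    · rwa [abs_of_nonneg (by positivity)]
    · rwa [abs_of_nonneg (by linarith)]
  · rw [abs_of_nonpos h0] at ha ⊢
    obtain ⟨k, k0, kN, h1, h2⟩ := key (-a) (by linarith) ha
    have hk : (0 : ℝ) ≤ k := by exact_mod_cast k0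
    refine ⟨-k, Finset.mem_Icc.2 ⟨by omega, by omega⟩, ?_, ?_⟩
    · push_cast
      rwa [mul_neg, abs_neg, abs_of_nonneg (by positivity)]
    · push_cast
      rw [abs_sub_comm, abs_of_nonneg (by linarith)]
      linarith

lemma exists_mem_grid {h : ℝ} (hh : 0 < h) {N : ℕ} {v : V} (hv : ‖v‖ ≤ h * N) :
    ∃ v' ∈ grid d h N, ‖v'‖ ≤ ‖v‖ ∧ ∀ j, |(v - v') j| ≤ h := by
  have hc : ∀ j, |v j| ≤ h * N := fun j => (PiLp.norm_apply_le v j).trans hv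
  choose k hk1 hk2 hk3 using fun j => exists_int_round_toward_zero hh (hc j)
  refine ⟨WithLp.toLp 2 fun j => h * (k j : ℝ),
    Finset.mem_image.2 ⟨k, Fintype.mem_piFinset.2 hk1, rfl⟩, ?_, fun j => ?_⟩
  · rw [EuclideanSpace.norm_eq, EuclideanSpace.norm_eq]
    gcongr with j
    simpa using hk2 j
  · simpa using hk3 j

lemma abs_inner_le_of_abs_le {x v : V} {B h : ℝ} (hB : 0 ≤ B) (hx : ∀ j, |x j| ≤ B)
    (hv : ∀ j, |v j| ≤ h) : |inner ℝ x v| ≤ d * (B * h) := by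
  rw [PiLp.inner_apply]
  refine (Finset.abs_sum_le_sum_abs _ _).trans ?_
  calc _ ≤ ∑ _j : Fin d, B * h := by
        refine Finset.sum_le_sum fun j _ => ?_
        rw [real_inner_eq_re_inner]
        simp only [RCLike.inner_apply, conj_trivial, abs_mul, RCLike.re_to_real]
        rw [mul_comm]
        exact mul_le_mul (hx j) (hv j) (abs_nonneg _) hB
    _ = d * (B * h) := by simp

lemma norm_le_of_abs_le {v : V} {h : ℝ} (hh : 0 ≤ h) (hv : ∀ j, |v j| ≤ h) : ‖v‖ ≤ d * h := by
  by_cases hv0 : v = 0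
  · rw [hv0, norm_zero]
    positivity
  have hn : 0 < ‖v‖ := norm_pos_iff.2 hv0
  have h1 := abs_inner_le_of_abs_le (norm_nonneg v) (fun j => PiLp.norm_apply_le v j) hv
  rw [real_inner_self_eq_norm_sq, abs_of_nonneg (sq_nonneg _)] at h1
  nlinarith

/-- The second conclusion is the logarithm of the union bound over (A n²)^{3d} triples. The log n is
traded for log(d+1) through log(δn/d) ≤ δn/d, at the price of a small multiple of n. -/
lemma exists_sample_size_bound {A c : ℝ} (hA : 1 ≤ A) (hc : 0 < c) :
    ∃ C : ℝ, 0 < C ∧ ∀ d n : ℕ, 1 ≤ d → C * (d * Real.log (d + 1)) ≤ (n : ℝ) →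
      d ≤ n ∧ Real.log 6 + 3 * (d * Real.log (A * n ^ 2)) ≤ c * n := by
  set δ := c / 12 with hδ
  have hδ0 : 0 < δ := by positivity
  set L := |Real.log δ| with hL
  have hL0 : 0 ≤ L := abs_nonneg _
  have hlA : 0 ≤ Real.log A := Real.log_nonneg hA
  -- K collects all terms of order n/C; the term 6δn is c/2 · n, and C is chosen so that K/C ≤ c/2.
  -- The summand 2 in C forces d ≤ n.
  set K := 11 + 6 * Real.log A + 12 * L with hK
  have hK0 : 0 < K := by positivity
  refine ⟨2 * K / c + 2, by positivity, fun d n hd hn => ?_⟩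
  set C := 2 * K / c + 2 with hC
  have hC0 : 0 < C := by positivity
  have hd' : (1 : ℝ) ≤ d := by exact_mod_cast hd
  have hl2 : 1 / 2 ≤ Real.log (d + 1) := by
    have h1 : Real.log 2 ≤ Real.log (d + 1) := Real.log_le_log (by norm_num) (by linarith)
    have := Real.log_two_gt_d9
    linarith
  have hCd : C * d ≤ 2 * n := by
    have : C * (d * (1 / 2)) ≤ C * (d * Real.log (d + 1)) := by gcongr
    linarith
  have hdn : (d : ℝ) ≤ n := by
    have : 2 * (d : ℝ) ≤ C * d := by
      gcongr
      rw [hC]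
      linarith [show 0 ≤ 2 * K / c by positivity]
    linarith
  refine ⟨by exact_mod_cast hdn, ?_⟩
  have hd0 : (0 : ℝ) < d := by linarith
  have hn0 : (0 : ℝ) < n := by linarith
  have hlog : Real.log (A * n ^ 2) = Real.log A + 2 * Real.log n := by
    rw [Real.log_mul (by linarith) (by positivity), Real.log_pow]
    push_cast
    ring
  have hlogn : Real.log n ≤ Real.log (d + 1) + δ * (n / d) + L := by
    have e : (n : ℝ) = d * (δ * (n / d)) / δ := by field_simp
    have h1 : Real.log n = Real.log d + Real.log (δ * (n / d)) - Real.log δ := by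
      conv_lhs => rw [e]
      rw [Real.log_div (by positivity) hδ0.ne', Real.log_mul hd0.ne' (by positivity)]
    have h2 : Real.log (δ * (n / d)) ≤ δ * (n / d) := Real.log_le_self (by positivity)
    have h3 : Real.log d ≤ Real.log (d + 1) := Real.log_le_log hd0 (by linarith)
    have h4 : -Real.log δ ≤ L := neg_le_abs _
    linarith
  have hdlogn : d * Real.log n ≤ d * Real.log (d + 1) + δ * n + d * L := by
    have := mul_le_mul_of_nonneg_left hlogn hd0.le
    have e : d * (δ * ((n : ℝ) / d)) = δ * n := by field_simp
    linarith
  have hl6 : Real.log 6 ≤ 5 / 2 * d := by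
    have h1 : Real.log 6 ≤ Real.log 8 := Real.log_le_log (by norm_num) (by norm_num)
    have h2 : Real.log 8 = 3 * Real.log 2 := by
      rw [show (8 : ℝ) = 2 ^ 3 by norm_num, Real.log_pow]
      norm_num
    have := Real.log_two_lt_d9
    nlinarith
  have hdC : (d : ℝ) ≤ 2 * n / C := by rw [le_div_iff₀ hC0]; linarith
  have hdlC : d * Real.log (d + 1) ≤ n / C := by rw [le_div_iff₀ hC0]; linarith
  have htot : Real.log 6 + 3 * (d * Real.log (A * n ^ 2)) ≤ K * (n / C) + 6 * δ * n := by
    rw [hlog]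
    have h1 := mul_le_mul_of_nonneg_right hdC hlA
    have h2 := mul_le_mul_of_nonneg_right hdC hL0
    rw [mul_div_assoc] at h1 h2 hdC
    rw [hK]
    nlinarith
  have hKC : K * (n / C) ≤ c / 2 * n := by
    rw [← mul_div_assoc, div_le_iff₀ hC0]
    have : c / 2 * n * C = K * n + c * n := by
      rw [hC]
      field_simp
    rw [this]
    linarith [mul_pos hc hn0]
  have : 6 * δ * n = c / 2 * n := by rw [hδ]; ring
  linarith

/-! ### Perturbation and the high-probability event -/

/-- The Lipschitz bound costs 2(η + 2η)y², and replacing y' by y costs 13/80 · η(2 + y²). The loss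
involves only y, so a second-moment bound controls its sum. -/
lemma curvature_mul_sq_perturb {a b y a' b' y' η : ℝ} (hη : η ≤ 1) (ha : |a - a'| ≤ η)
    (hb : |b - b'| ≤ 2 * η) (hy : |y - y'| ≤ η) :
    curvature a' b' * y' ^ 2 - 7 * η * y ^ 2 - η ≤ curvature a b * y ^ 2 := by
  have hη0 : 0 ≤ η := (abs_nonneg _).trans ha
  have h1 := (abs_le.1 (abs_curvature_sub_le a b a' b')).1
  have h2 : (curvature a' b' - 6 * η) * y ^ 2 ≤ curvature a b * y ^ 2 :=
    mul_le_mul_of_nonneg_right (by linarith) (sq_nonneg y)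
  have h3 : |y' ^ 2 - y ^ 2| ≤ η * (2 + y ^ 2) := by
    rw [show y' ^ 2 - y ^ 2 = -(y - y') * (2 * y - (y - y')) by ring, abs_mul, abs_neg]
    have h4 : |2 * y - (y - y')| ≤ 2 * |y| + η := by
      refine (abs_sub _ _).trans ?_
      rw [abs_mul, abs_two]
      linarith
    have h5 : 2 * |y| ≤ 1 + y ^ 2 := by nlinarith [sq_nonneg (|y| - 1), sq_abs y]
    exact mul_le_mul hy (by linarith) (abs_nonneg _) hη0
  have h6 : curvature a' b' * (y' ^ 2 - y ^ 2) ≤ 13 / 80 * (η * (2 + y ^ 2)) := by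
    refine (le_abs_self _).trans ?_
    rw [abs_mul]
    exact mul_le_mul (abs_curvature_le a' b') h3 (abs_nonneg _) (by norm_num)
  nlinarith [mul_nonneg hη0 (sq_nonneg y)]

/-- The sample `x` has bounded entries, and on the grid its empirical second moments and empirical
curvature averages are close to their expectations. -/
structure GoodSample (x : Fin n → V) (T : Finset V) (ε : ℝ) : Prop where
  abs_le : ∀ i j, |x i j| ≤ n
  sum_sq_le : ∀ z ∈ T, ‖z‖ ≤ 1 → ∑ i, inner ℝ (x i) z ^ 2 ≤ 5 / 4 * (n : ℝ)
  sum_curvature_ge : ∀ p ∈ T, ∀ u ∈ T, ∀ z ∈ T, ‖z‖ ≤ 1 →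
    n * ((∫ x, curvature (inner ℝ x p) (inner ℝ x (p - u)) * inner ℝ x z ^ 2 ∂stdGaussian V) - ε) ≤
      ∑ i, curvature (inner ℝ (x i) p) (inner ℝ (x i) (p - u)) * inner ℝ (x i) z ^ 2

lemma measureReal_biUnion_le_card_mul {Ω ι : Type*} [MeasurableSpace Ω] {P : Measure Ω}
    (S : Finset ι) {B : ι → Set Ω} {q : ℝ} (h : ∀ i ∈ S, P.real (B i) ≤ q) :
    P.real (⋃ i ∈ S, B i) ≤ S.card * q := by
  refine (measureReal_biUnion_finset_le _ _).trans ?_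
  rw [← nsmul_eq_mul]
  exact Finset.sum_le_card_nsmul _ _ _ h

/-- A union bound over nd entries, at most K second moments and at most K³ triples, each failing
with probability at most 2e^{-ε²n/768}. Half of the exponent pays for the factor 6K³. -/
lemma exists_event_goodSample {Ω : Type*} [MeasurableSpace Ω] {P : Measure Ω}
    [IsProbabilityMeasure P] {X : Fin n → Ω → V} (hX : iIndepFun X P)
    (hL : ∀ i, HasLaw (X i) (stdGaussian V) P) (hd : 1 ≤ d) (hn : 1 ≤ n) (T : Finset V) {ε K : ℝ}
    (hε : 0 ≤ ε) (hε1 : ε ≤ 1 / 4) (hK : 1 ≤ K) (hnd : (n * d : ℝ) ≤ K) (hT : (T.card : ℝ) ≤ K)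
    (hKe : 6 * K ^ 3 ≤ Real.exp (ε ^ 2 / 1536 * n)) :
    ∃ E : Set Ω, MeasurableSet E ∧ 1 - Real.exp (-(ε ^ 2 / 1536 * n)) ≤ P.real E ∧
      ∀ ω ∈ E, GoodSample (fun i => X i ω) T ε := by
  have hn' : (1 : ℝ) ≤ n := by exact_mod_cast hn
  have hunit : ‖(EuclideanSpace.single (⟨0, hd⟩ : Fin d) (1 : ℝ) : V)‖ = 1 := by simp
  have hsq : ∀ z : V, ‖z‖ ≤ 1 → ∃ e : V, ‖e‖ = 1 ∧ ∀ x, inner ℝ x z ^ 2 ≤ inner ℝ x e ^ 2 := by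
    intro z hz
    obtain ⟨e, he, hze⟩ := exists_unit_smul z _ hunit
    refine ⟨e, he, fun x => ?_⟩
    rw [hze, real_inner_smul_right, mul_pow]
    have : ‖z‖ ^ 2 ≤ 1 := pow_le_one₀ (norm_nonneg z) hz
    nlinarith [sq_nonneg (inner ℝ x e : ℝ)]
  obtain ⟨q, hq⟩ : ∃ q, q = Real.exp (-(ε ^ 2 / 768 * n)) := ⟨_, rfl⟩
  have hq0 : 0 < q := hq ▸ Real.exp_pos _
  obtain ⟨B1, hB1⟩ : ∃ B : Fin n × Fin d → Set Ω, B = fun a => {ω | (n : ℝ) ≤ |inner ℝ (X a.1 ω)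
    (EuclideanSpace.single a.2 (1 : ℝ) : V)|} := ⟨_, rfl⟩
  obtain ⟨B2, hB2⟩ : ∃ B : V → Set Ω, B = fun z => {ω | ∑ i, -(inner ℝ (X i ω) z ^ 2) ≤
    n * ((∫ x : V, -(inner ℝ x z ^ 2) ∂stdGaussian V) - 1 / 4)} := ⟨_, rfl⟩
  obtain ⟨B3, hB3⟩ : ∃ B : V × V × V → Set Ω, B = fun t =>
    {ω | ∑ i, curvature (inner ℝ (X i ω) t.1) (inner ℝ (X i ω) (t.1 - t.2.1)) *
        inner ℝ (X i ω) t.2.2 ^ 2 ≤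
      n * ((∫ x : V, curvature (inner ℝ x t.1) (inner ℝ x (t.1 - t.2.1)) * inner ℝ x t.2.2 ^ 2
        ∂stdGaussian V) - ε)} := ⟨_, rfl⟩
  obtain ⟨T1, hT1⟩ : ∃ S, S = T.filter fun z => ‖z‖ ≤ 1 := ⟨_, rfl⟩
  have hT1m : ∀ z, z ∈ T1 ↔ z ∈ T ∧ ‖z‖ ≤ 1 := fun z => by rw [hT1, Finset.mem_filter]
  have hT1c : (T1.card : ℝ) ≤ K :=
    le_trans (by rw [hT1]; exact_mod_cast Finset.card_filter_le _ _) hT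
  have hε2 : ε ^ 2 ≤ 1 / 16 := by nlinarith
  have P1 : ∀ a, P.real (B1 a) ≤ 2 * q := by
    intro a
    rw [hB1]
    refine (measureReal_abs_inner_ge_le hL a.1 _ (by simp) (by positivity)).trans ?_
    rw [hq]
    gcongr 2 * Real.exp (-?_)
    nlinarith
  have P2 : ∀ z ∈ T1, P.real (B2 z) ≤ q := by
    intro z hz
    obtain ⟨e, he, hze⟩ := hsq z ((hT1m z).1 hz).2
    rw [hB2]
    refine (measureReal_sum_le_le_exp hX hL (g := fun x => -(inner ℝ x z ^ 2)) (by fun_prop) e he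
      (fun x => ?_) (ε := 1 / 4) (by norm_num) (by norm_num)).trans ?_
    · rw [abs_neg, abs_of_nonneg (sq_nonneg _)]
      exact hze x
    · rw [hq]
      gcongr Real.exp (-?_)
      nlinarith
  have P3 : ∀ t ∈ T ×ˢ T ×ˢ T1, P.real (B3 t) ≤ q := by
    intro t ht
    simp only [Finset.mem_product] at ht
    obtain ⟨e, he, hze⟩ := hsq t.2.2 ((hT1m _).1 ht.2.2).2
    rw [hB3, hq]
    refine measureReal_sum_le_le_exp hX hL
      (g := fun x => curvature (inner ℝ x t.1) (inner ℝ x (t.1 - t.2.1)) * inner ℝ x t.2.2 ^ 2)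
      ?_ e he (fun x => ?_) hε (by linarith)
    · exact (continuous_curvature.measurable.comp (by fun_prop :
        Measurable fun x : V => (inner ℝ x t.1, inner ℝ x (t.1 - t.2.1)))).mul (by fun_prop)
    · rw [abs_mul, abs_of_nonneg (sq_nonneg (inner ℝ x t.2.2 : ℝ))]
      have := abs_curvature_le (inner ℝ x t.1) (inner ℝ x (t.1 - t.2.1))
      nlinarith [hze x, sq_nonneg (inner ℝ x t.2.2 : ℝ)]
  obtain ⟨B, hB⟩ : ∃ B : Set Ω, B = (⋃ a ∈ (Finset.univ : Finset (Fin n × Fin d)), B1 a) ∪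
    ((⋃ z ∈ T1, B2 z) ∪ ⋃ t ∈ T ×ˢ T ×ˢ T1, B3 t) := ⟨_, rfl⟩
  have hBm : P.real B ≤ Real.exp (-(ε ^ 2 / 1536 * n)) := by
    have m1 := measureReal_biUnion_le_card_mul (P := P) (Finset.univ : Finset (Fin n × Fin d))
      fun a _ => P1 a
    have m2 := measureReal_biUnion_le_card_mul T1 P2
    have m3 := measureReal_biUnion_le_card_mul (T ×ˢ T ×ˢ T1) P3
    rw [Finset.card_univ, Fintype.card_prod, Fintype.card_fin, Fintype.card_fin,
      Nat.cast_mul] at m1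
    rw [Finset.card_product, Finset.card_product, Nat.cast_mul, Nat.cast_mul] at m3
    have mB : P.real B ≤ 6 * K ^ 3 * q := by
      have u1 := measureReal_union_le (μ := P)
        (⋃ a ∈ (Finset.univ : Finset (Fin n × Fin d)), B1 a)
        ((⋃ z ∈ T1, B2 z) ∪ ⋃ t ∈ T ×ˢ T ×ˢ T1, B3 t)
      have u2 := measureReal_union_le (μ := P) (⋃ z ∈ T1, B2 z) (⋃ t ∈ T ×ˢ T ×ˢ T1, B3 t)
      have k1 : (n * d : ℝ) * (2 * q) ≤ K * (2 * q) := by gcongr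
      have k2 : (T1.card : ℝ) * q ≤ K * q := by gcongr
      have k3 : (T.card : ℝ) * (T.card * T1.card) * q ≤ K * (K * K) * q := by gcongr
      have k4 : K * q ≤ K ^ 3 * q := by
        gcongr
        exact le_self_pow₀ hK (by norm_num)
      have k5 : 0 < K ^ 3 * q := by positivity
      rw [hB]
      linarith
    calc P.real B ≤ 6 * K ^ 3 * q := mB
      _ ≤ Real.exp (ε ^ 2 / 1536 * n) * q := by gcongr
      _ = _ := by
        rw [hq, ← Real.exp_add]
        congr 1
        ring
  -- The X i are only a.e. measurable, so the bad set is replaced by a measurable hull of equal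
  -- measure.
  refine ⟨(toMeasurable P B)ᶜ, (measurableSet_toMeasurable P B).compl, ?_, fun ω hω => ?_⟩
  · rw [probReal_compl_eq_one_sub (measurableSet_toMeasurable P B), measureReal_def,
      measure_toMeasurable, ← measureReal_def]
    linarith
  · have hωB : ω ∉ B := fun h => hω (subset_toMeasurable P B h)
    simp only [hB, Set.mem_union, Set.mem_iUnion, not_or, not_exists] at hωB
    obtain ⟨h1, h2, h3⟩ := hωB
    refine ⟨fun i j => ?_, fun z hz hz1 => ?_, fun p hp u hu z hz hz1 => ?_⟩
    · have := h1 (i, j) (Finset.mem_univ _)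
      simp only [hB1, Set.mem_ofPred_eq, not_le, EuclideanSpace.inner_single_right, one_mul,
        conj_trivial] at this
      exact this.le
    · have := h2 z ((hT1m z).2 ⟨hz, hz1⟩)
      simp only [hB2, Set.mem_ofPred_eq, not_le, Finset.sum_neg_distrib, integral_neg,
        integral_inner_sq_stdGaussian] at this
      have hz2 : ‖z‖ ^ 2 ≤ 1 := pow_le_one₀ (norm_nonneg z) hz1
      nlinarith
    · have := h3 (p, u, z) (Finset.mem_product.2 ⟨hp, Finset.mem_product.2
        ⟨hu, (hT1m z).2 ⟨hz, hz1⟩⟩⟩)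
      simp only [hB3, Set.mem_ofPred_eq, not_le] at this
      exact this.le

/-! ### From the net to all vectors -/

/-- `T` contains, for every vector `v` of norm at most `ρ`, a vector of smaller norm at entrywise
distance at most `h`. -/
def IsNet (T : Finset V) (ρ h : ℝ) : Prop :=
  ∀ v : V, ‖v‖ ≤ ρ → ∃ v' ∈ T, ‖v'‖ ≤ ‖v‖ ∧ ∀ j, |(v - v') j| ≤ h

namespace GoodSample

variable {x : Fin n → EuclideanSpace ℝ (Fin d)} {T : Finset (EuclideanSpace ℝ (Fin d))}
  {ε ρ h η : ℝ}

/-- This fixes the mesh: entries at most n and d ≤ n give d · n · h ≤ n²h = η. -/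
lemma abs_inner_le (hx : GoodSample x T ε) (hdn : d ≤ n) (hh : h * n ^ 2 = η) (hh0 : 0 ≤ h)
    {v : V} (hv : ∀ j, |v j| ≤ h) (i : Fin n) : |inner ℝ (x i) v| ≤ η := by
  refine (abs_inner_le_of_abs_le n.cast_nonneg (hx.abs_le i) hv).trans ?_
  have : (d : ℝ) ≤ n := by exact_mod_cast hdn
  calc (d : ℝ) * (n * h) ≤ n * (n * h) := by gcongr
    _ = η := by rw [← hh]; ring

lemma sum_inner_sq_le (hx : GoodSample x T ε) (hT : IsNet T ρ h) (hdn : d ≤ n)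
    (hh : h * n ^ 2 = η) (hh0 : 0 ≤ h) (hη : η ≤ 1 / 10) (hρ : 1 ≤ ρ) {z : V} (hz : ‖z‖ = 1) :
    ∑ i, inner ℝ (x i) z ^ 2 ≤ 3 * (n : ℝ) := by
  obtain ⟨z', hz'T, hz'n, hz'⟩ := hT z (hz ▸ hρ)
  have h1 := hx.sum_sq_le z' hz'T (hz ▸ hz'n)
  have h2 : ∀ i, inner ℝ (x i) z ^ 2 ≤ 2 * inner ℝ (x i) z' ^ 2 + 1 / 50 := by
    intro i
    have h3 := hx.abs_inner_le hdn hh hh0 hz' i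
    have h4 : (inner ℝ (x i) (z - z') : ℝ) ^ 2 ≤ (1 / 10) ^ 2 := by
      rw [← sq_abs]
      have := abs_nonneg (inner ℝ (x i) (z - z') : ℝ)
      gcongr
      linarith
    rw [inner_sub_right] at h4
    nlinarith [sq_nonneg (2 * inner ℝ (x i) z' - inner ℝ (x i) z : ℝ)]
  calc _ ≤ ∑ i, (2 * inner ℝ (x i) z' ^ 2 + 1 / 50) := Finset.sum_le_sum fun i _ => h2 i
    _ = 2 * ∑ i, inner ℝ (x i) z' ^ 2 + n * (1 / 50) := by
        rw [Finset.sum_add_distrib, ← Finset.mul_sum]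
        simp
    _ ≤ _ := by linarith [n.cast_nonneg (α := ℝ)]

/-- Rounding costs 7η · 3 + η = 22η per sample. Since ‖z'‖² ≥ 81/100, what remains is at least
81/20000 - 1/1000 > 1/400, in units of e^{-τR}. -/
lemma sum_curvature_mul_ge (hx : GoodSample x T ε) (hT : IsNet T ρ h) (hdn : d ≤ n) (hn : 1 ≤ n)
    (hh : h * n ^ 2 = η) (hh0 : 0 ≤ h) (hη : η ≤ 1 / 10) (hρ : 1 ≤ ρ) {R τ : ℝ} (hR : 0 ≤ R)
    (hτ1 : τ ≤ 1) (hεη : ε + 22 * η ≤ Real.exp (-R) / 1000) {p u z : V} (hz : ‖z‖ = 1)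
    (hp : ‖p‖ ≤ τ * R + 1 / 3) (hu : ‖u‖ ≤ Real.exp (-R) / 3) (hpρ : ‖p‖ ≤ ρ) (huρ : ‖u‖ ≤ ρ) :
    n * (1 / 400 * Real.exp (-(τ * R))) ≤
      ∑ i, curvature (inner ℝ (x i) p) (inner ℝ (x i) (p - u)) * inner ℝ (x i) z ^ 2 := by
  obtain ⟨z', hz'T, hz'n, hz'⟩ := hT z (hz ▸ hρ)
  obtain ⟨p', hp'T, hp'n, hp'⟩ := hT p hpρ
  obtain ⟨u', hu'T, hu'n, hu'⟩ := hT u huρ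
  have hn' : (1 : ℝ) ≤ n := by exact_mod_cast hn
  have hdn' : (d : ℝ) ≤ n := by exact_mod_cast hdn
  have h1 := hx.sum_curvature_ge p' hp'T u' hu'T z' hz'T (hz ▸ hz'n)
  have h2 := integral_curvature_ge hR hτ1 p' u' z' (hp'n.trans hp) (hu'n.trans hu)
  have h3 : 9 / 10 ≤ ‖z'‖ := by
    have a1 := norm_le_of_abs_le hh0 hz'
    have a2 : (d : ℝ) * h ≤ h * n ^ 2 := by
      rw [mul_comm]
      gcongr
      nlinarith
    have a3 := norm_sub_norm_le z z'
    linarith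
  have h4 : 81 / 100 ≤ ‖z'‖ ^ 2 := by nlinarith
  have h5 : ∀ i, curvature (inner ℝ (x i) p') (inner ℝ (x i) (p' - u')) * inner ℝ (x i) z' ^ 2 -
      7 * η * inner ℝ (x i) z ^ 2 - η ≤
      curvature (inner ℝ (x i) p) (inner ℝ (x i) (p - u)) * inner ℝ (x i) z ^ 2 := by
    intro i
    have b1 := hx.abs_inner_le hdn hh hh0 hp' i
    have b2 := hx.abs_inner_le hdn hh hh0 hu' i
    have b3 := hx.abs_inner_le hdn hh hh0 hz' i
    refine curvature_mul_sq_perturb (by linarith) (by rwa [← inner_sub_right]) ?_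
      (by rwa [← inner_sub_right])
    rw [← inner_sub_right, show p - u - (p' - u') = (p - p') - (u - u') by abel, inner_sub_right]
    refine (abs_sub _ _).trans ?_
    linarith
  have h6 := hx.sum_inner_sq_le hT hdn hh hh0 hη hρ hz
  have h7 := Finset.sum_le_sum fun i (_ : i ∈ Finset.univ) => h5 i
  rw [Finset.sum_sub_distrib, Finset.sum_sub_distrib, ← Finset.mul_sum] at h7
  simp only [Finset.sum_const, Finset.card_univ, Fintype.card_fin, nsmul_eq_mul] at h7
  have hη0 : 0 ≤ η := by rw [← hh]; positivity
  have h8 : 7 * η * ∑ i, inner ℝ (x i) z ^ 2 ≤ 7 * η * (3 * n) := by gcongr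
  have h9 : Real.exp (-R) ≤ Real.exp (-(τ * R)) := by
    apply Real.exp_le_exp.2
    nlinarith
  have h10 : 1 / 200 * Real.exp (-(τ * R)) * (81 / 100) ≤
      1 / 200 * Real.exp (-(τ * R)) * ‖z'‖ ^ 2 := by gcongr
  have h11 : 1 / 400 * Real.exp (-(τ * R)) ≤
      (∫ x, curvature (inner ℝ x p') (inner ℝ x (p' - u')) * inner ℝ x z' ^ 2 ∂stdGaussian V) -
        ε - 22 * η := by
    linarith [Real.exp_pos (-(τ * R))]
  have h12 := mul_le_mul_of_nonneg_left h11 (show (0 : ℝ) ≤ n by linarith)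
  linarith

lemma hessianForm_bounds (hx : GoodSample x T ε) {R τ r : ℝ} (hR : 0 ≤ R) (hT : IsNet T (R + 1) h)
    (hdn : d ≤ n) (hn : 1 ≤ n) (hh : h * n ^ 2 = η) (hh0 : 0 ≤ h) (hη : η ≤ 1 / 10)
    (hτ : 0 ≤ τ) (hτ1 : τ ≤ 1) (hεη : ε + 22 * η ≤ Real.exp (-R) / 1000)
    (hτr : τ * (3 * r) ≤ Real.exp (-R)) {wstar w : V} (hws : ‖wstar‖ ≤ R)
    (hw : w ∈ Metric.closedBall wstar r) (z : V) :
    τ ^ 2 * Real.exp (-(τ * R)) / 200 * ‖z‖ ^ 2 ≤ hessianForm x wstar τ w z ∧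
      hessianForm x wstar τ w z ≤ τ ^ 2 * ‖z‖ ^ 2 := by
  by_cases hz0 : z = 0
  · simp [hz0, hessianForm]
  have hzn : ‖z‖ ≠ 0 := norm_ne_zero_iff.2 hz0
  obtain ⟨e, he, hze⟩ := exists_unit_smul z (‖z‖⁻¹ • z)
    (by rw [norm_smul, norm_inv, norm_norm, inv_mul_cancel₀ hzn])
  have hn0 : (0 : ℝ) < n := by exact_mod_cast hn
  set S := ∑ i, curvature (τ * inner ℝ (x i) w) (τ * inner ℝ (x i) wstar) * inner ℝ (x i) e ^ 2
    with hS
  have hform : hessianForm x wstar τ w z = 2 * τ ^ 2 / n * S * ‖z‖ ^ 2 := by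
    rw [hessianForm, hS, Finset.mul_sum, Finset.mul_sum, Finset.sum_mul]
    refine Finset.sum_congr rfl fun i _ => ?_
    conv_lhs => rw [hze]
    rw [real_inner_smul_right]
    ring
  have hwr : ‖w - wstar‖ ≤ r := mem_closedBall_iff_norm.1 hw
  have hexp : Real.exp (-R) ≤ 1 := Real.exp_le_one_iff.2 (by linarith)
  have hu : ‖τ • (w - wstar)‖ ≤ Real.exp (-R) / 3 := by
    rw [norm_smul, Real.norm_eq_abs, abs_of_nonneg hτ]
    nlinarith
  have hpu : τ • w - τ • (w - wstar) = τ • wstar := by rw [← smul_sub, sub_sub_cancel]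
  have hp : ‖τ • w‖ ≤ τ * R + 1 / 3 := by
    have e1 : τ • w = τ • wstar + τ • (w - wstar) := by rw [← hpu]; abel
    rw [e1]
    refine (norm_add_le _ _).trans ?_
    have : ‖τ • wstar‖ ≤ τ * R := by
      rw [norm_smul, Real.norm_eq_abs, abs_of_nonneg hτ]
      gcongr
    linarith
  -- Applied with p = τw and u = τ(w - w*), so that p - u = τw*; both lie within the net's radius R
  -- + 1.
  have hlow := hx.sum_curvature_mul_ge hT hdn hn hh hh0 hη (by linarith) hR hτ1 hεη he hp hu
    (by nlinarith) (by linarith)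
  rw [hpu] at hlow
  simp only [real_inner_smul_right] at hlow
  rw [← hS] at hlow
  have hup : S ≤ 13 / 80 * (3 * n) := by
    calc S ≤ ∑ i, 13 / 80 * inner ℝ (x i) e ^ 2 := by
          refine Finset.sum_le_sum fun i _ => ?_
          gcongr
          exact (le_abs_self _).trans (abs_curvature_le _ _)
      _ ≤ _ := by
          rw [← Finset.mul_sum]
          gcongr
          exact hx.sum_inner_sq_le hT hdn hh hh0 hη (by linarith) he
  rw [hform]
  constructor
  · gcongr
    calc τ ^ 2 * Real.exp (-(τ * R)) / 200 =
          2 * τ ^ 2 / n * (n * (1 / 400 * Real.exp (-(τ * R)))) := by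
          field_simp
          ring
      _ ≤ _ := by gcongr
  · gcongr
    calc 2 * τ ^ 2 / n * S ≤ 2 * τ ^ 2 / n * (13 / 80 * (3 * n)) := by gcongr
      _ = 39 / 40 * τ ^ 2 := by
          field_simp
          ring
      _ ≤ _ := by linarith [sq_nonneg τ]

end GoodSample

/-! ### Smoothness constants, the net and the assembly -/

lemma sq_le_smooth_bound {τ R : ℝ} : τ ^ 2 ≤ τ ^ 2 * Real.exp (-(τ * R)) + τ ^ 3 * R := by
  have := Real.add_one_le_exp (-(τ * R))
  nlinarith [mul_nonneg (sq_nonneg τ) (show 0 ≤ Real.exp (-(τ * R)) - (1 - τ * R) by linarith)]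

lemma smooth_bound_le {τ R : ℝ} (hR : 0 ≤ R) (hτ : 0 ≤ τ) (hτ1 : τ ≤ 1) :
    τ ^ 2 * Real.exp (-(τ * R)) + τ ^ 3 * R ≤ τ ^ 2 * (1 + R) := by
  have h1 : Real.exp (-(τ * R)) ≤ 1 := Real.exp_le_one_iff.2 (by linarith [mul_nonneg hτ hR])
  have h2 : τ ^ 3 ≤ τ ^ 2 := pow_le_pow_of_le_one hτ hτ1 (by norm_num)
  have h3 := mul_le_mul_of_nonneg_left h1 (sq_nonneg τ)
  have h4 := mul_le_mul_of_nonneg_right h2 hR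
  linarith

lemma exists_net {d n : ℕ} (hn : 1 ≤ n) {ρ η A : ℝ} (hρ : 0 < ρ) (hη : 0 < η)
    (hA : 2 * ρ / η + 3 ≤ A) :
    ∃ T : Finset (EuclideanSpace ℝ (Fin d)), IsNet T ρ (η / n ^ 2) ∧
      (T.card : ℝ) ≤ (A * n ^ 2) ^ d := by
  have hn' : (1 : ℝ) ≤ n := by exact_mod_cast hn
  have hh : 0 < η / (n : ℝ) ^ 2 := by positivity
  refine ⟨grid d (η / n ^ 2) ⌈ρ * n ^ 2 / η⌉₊, fun v hv => exists_mem_grid hh (hv.trans ?_), ?_⟩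
  · calc ρ = η / n ^ 2 * (ρ * n ^ 2 / η) := by field_simp
      _ ≤ _ := by
        gcongr
        exact Nat.le_ceil _
  · have h1 : ((grid d (η / (n : ℝ) ^ 2) ⌈ρ * n ^ 2 / η⌉₊).card : ℝ) ≤
        ((2 * ⌈ρ * n ^ 2 / η⌉₊ + 1 : ℕ) : ℝ) ^ d := by
      exact_mod_cast card_grid_le _ _
    refine h1.trans ?_
    gcongr
    push_cast
    have h2 := (Nat.ceil_lt_add_one (show 0 ≤ ρ * n ^ 2 / η by positivity)).le
    have h3 : (1 : ℝ) ≤ n ^ 2 := one_le_pow₀ hn'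
    calc 2 * (⌈ρ * n ^ 2 / η⌉₊ : ℝ) + 1 ≤ 2 * (ρ * n ^ 2 / η + 1) + 1 := by gcongr
      _ = 2 * ρ / η * n ^ 2 + 3 := by ring
      _ ≤ (2 * ρ / η + 3) * n ^ 2 := by nlinarith
      _ ≤ A * n ^ 2 := by gcongr

end

end Agglio

theorem mainTheorem6 :
    ∃ c₀ : ℝ, 0 < c₀ ∧
      ∀ R : ℝ, ∃ C : ℝ, 0 < C ∧ ∃ c : ℝ, 0 < c ∧
        ∀ (d n : ℕ), C * (d * Real.log (d + 1)) ≤ (n : ℝ) →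
        ∀ wstar : EuclideanSpace ℝ (Fin d), ‖wstar‖ ≤ R →
        ∀ (Ω : Type*) [MeasurableSpace Ω] (P : Measure Ω) [IsProbabilityMeasure P]
          (X : Fin n → Ω → EuclideanSpace ℝ (Fin d)),
          iIndepFun X P →
          (∀ i, HasLaw (X i) (stdGaussian (EuclideanSpace ℝ (Fin d))) P) →
          ∃ E : Set Ω, MeasurableSet E ∧ 1 - Real.exp (-(c * n)) ≤ P.real E ∧
            ∀ ω ∈ E, ∀ r : ℝ, 0 ≤ r → r ≤ 2 * R →
            ∀ τ : ℝ, 0 < τ → τ ≤ 1 → τ * (3 * r) ≤ Real.exp (-R) →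
              ∃ lam Lam : ℝ, 0 < lam ∧ 0 < Lam ∧
                Agglio.StronglyConvexWithin
                  (Agglio.gradObjective (fun i => X i ω)
                    (Agglio.noiselessLabel (fun i => X i ω) wstar) τ)
                  (Metric.closedBall wstar r) lam ∧
                Agglio.StronglySmoothWithin
                  (Agglio.gradObjective (fun i => X i ω)
                    (Agglio.noiselessLabel (fun i => X i ω) wstar) τ)
                  (Metric.closedBall wstar r) Lam ∧
                c₀ * (τ ^ 2 * Real.exp (-(τ * R)) / 2) ≤ lam ∧
                c₀ * (τ ^ 2 * Real.exp (-R) / 2) ≤ c₀ * (τ ^ 2 * Real.exp (-(τ * R)) / 2) ∧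
                Lam ≤ τ ^ 2 * Real.exp (-(τ * R)) + τ ^ 3 * R ∧
                τ ^ 2 * Real.exp (-(τ * R)) + τ ^ 3 * R ≤ τ ^ 2 * (1 + R) := by
  -- With c₀ = 1/100 the required lower bound is exactly the Hessian constant τ²e^{-τR}/200.
  refine ⟨1 / 100, by norm_num, fun R => ?_⟩
  by_cases hR : R < 0
  · exact ⟨1, one_pos, 1, one_pos, fun d n _ wstar hw =>
      absurd ((norm_nonneg wstar).trans hw) (not_le.2 hR)⟩
  push Not at hR
  have hexp1 : Real.exp (-R) ≤ 1 := Real.exp_le_one_iff.2 (by linarith)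
  have hexp0 := Real.exp_pos (-R)
  -- Chosen so that ε + 22η ≤ e^{-R}/1000.
  set ε := Real.exp (-R) / 2000 with hε
  set η := Real.exp (-R) / 50000 with hη
  have hε0 : 0 < ε := by positivity
  have hη0 : 0 < η := by positivity
  set A := 2 * (R + 1) / η + 3 with hA
  have hA1 : 1 ≤ A := by
    have : 0 ≤ 2 * (R + 1) / η := by positivity
    linarith
  set c := ε ^ 2 / 1536 with hc
  have hc0 : 0 < c := by positivity
  obtain ⟨C, hC0, hC⟩ := Agglio.exists_sample_size_bound hA1 hc0
  refine ⟨C, hC0, c, hc0, fun d n hdn wstar hw Ω _ P _ X hX hL => ?_⟩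
  -- It suffices to find an event on which the Hessian form has the right bounds on the ball.
  suffices h : ∃ E : Set Ω, MeasurableSet E ∧ 1 - Real.exp (-(c * n)) ≤ P.real E ∧
      ∀ ω ∈ E, ∀ r : ℝ, ∀ τ : ℝ, 0 < τ → τ ≤ 1 → τ * (3 * r) ≤ Real.exp (-R) →
        ∀ w ∈ Metric.closedBall wstar r, ∀ z,
          τ ^ 2 * Real.exp (-(τ * R)) / 200 * ‖z‖ ^ 2 ≤
            Agglio.hessianForm (fun i => X i ω) wstar τ w z ∧
          Agglio.hessianForm (fun i => X i ω) wstar τ w z ≤ τ ^ 2 * ‖z‖ ^ 2 by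
    obtain ⟨E, hEm, hEP, hE⟩ := h
    refine ⟨E, hEm, hEP, fun ω hω r _ _ τ hτ hτ1 hτr =>
      ⟨τ ^ 2 * Real.exp (-(τ * R)) / 200, τ ^ 2, by positivity, by positivity,
        Agglio.stronglyConvexWithin_of_hessianForm _ _ _ (convex_closedBall _ _)
          fun w hw z => (hE ω hω r τ hτ hτ1 hτr w hw z).1,
        Agglio.stronglySmoothWithin_of_hessianForm _ _ _ (convex_closedBall _ _)
          fun w hw z => (hE ω hω r τ hτ hτ1 hτr w hw z).2,
        by linarith, ?_, Agglio.sq_le_smooth_bound, Agglio.smooth_bound_le hR hτ.le hτ1⟩⟩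
    gcongr
    nlinarith
  -- In dimension 0 every direction z vanishes, and n may be 0; for d ≥ 1 the sample size gives n ≥
  -- d ≥ 1.
  rcases Nat.eq_zero_or_pos d with hd | hd
  · subst hd
    refine ⟨Set.univ, MeasurableSet.univ, ?_, fun ω _ r τ _ _ _ w _ z => ?_⟩
    · rw [probReal_univ]
      linarith [Real.exp_pos (-(c * n))]
    · have hz : z = 0 := Subsingleton.elim _ _
      simp [hz, Agglio.hessianForm]
  obtain ⟨hdn', hlog⟩ := hC d n hd hdn
  have hn : 1 ≤ n := hd.trans_le hdn'
  have hn' : (1 : ℝ) ≤ n := by exact_mod_cast hn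
  have hdn'' : (d : ℝ) ≤ n := by exact_mod_cast hdn'
  obtain ⟨T, hT, hTc⟩ := Agglio.exists_net hn (show 0 < R + 1 by linarith) hη0 hA.ge
  have hb : (n : ℝ) ^ 2 ≤ A * n ^ 2 := le_mul_of_one_le_left (by positivity) hA1
  have hb1 : 1 ≤ A * (n : ℝ) ^ 2 := (one_le_pow₀ hn').trans hb
  have hK : 1 ≤ (A * (n : ℝ) ^ 2) ^ d := one_le_pow₀ hb1
  have hnd : (n : ℝ) * d ≤ (A * (n : ℝ) ^ 2) ^ d :=
    calc (n : ℝ) * d ≤ n ^ 2 := by nlinarith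
      _ ≤ A * n ^ 2 := hb
      _ ≤ _ := le_self_pow₀ hb1 (by omega)
  have hKe : 6 * ((A * (n : ℝ) ^ 2) ^ d) ^ 3 ≤ Real.exp (ε ^ 2 / 1536 * n) := by
    have hpos : 0 < 6 * ((A * (n : ℝ) ^ 2) ^ d) ^ 3 := by positivity
    rw [← Real.log_le_iff_le_exp hpos, Real.log_mul (by norm_num) (by positivity), Real.log_pow,
      Real.log_pow]
    push_cast
    exact hlog
  obtain ⟨E, hEm, hEP, hE⟩ := Agglio.exists_event_goodSample hX hL hd hn T hε0.le
    (by rw [hε]; linarith) hK hnd hTc hKe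
  refine ⟨E, hEm, hEP, fun ω hω r τ hτ hτ1 hτr w hwr z => ?_⟩
  refine (hE ω hω).hessianForm_bounds (η := η) hR hT hdn' hn ?_ (by positivity)
    (by rw [hη]; linarith) hτ.le hτ1 (by rw [hε, hη]; linarith) hτr hw hwr z
  field_simp
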